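/- Let $\widetilde{\mathrm{SV}}=\mathbb{C}[\partial]L\oplus\mathbb{C}[\partial]M\oplus\mathbb{C}[\partial]Y\oplus\mathbb{C}[\partial]N$ be the extended Schr\"odinger--Virasoro Lie conformal algebra, a free $\mathbb{C}[\partial]$-module with $\lambda$-brackets $[L_\lambda L]=(\partial+2\lambda)L$, $[L_\lambda Y]=(\partial+\tfrac32\lambda)Y$, $[L_\lambda M]=(\partial+\lambda)M$, $[L_\lambda N]=(\partial+\lambda)N$, $[Y_\lambda Y]=(\partial+2\lambda)M$, $[N_\lambda M]=2M$, $[N_\lambda Y]=Y$, the brackets in the opposite order being determined by skew-symmetry and all other brackets of generators being zero. For $\alpha,\beta,\Delta\in\mathbb{C}$ let $V(\alpha,\beta,\Delta)=\mathbb{C}[\partial]v_\Delta$ be the conformal $\widetilde{\mathrm{SV}}$-module with $L_\lambda v_\Delta=(\partial+\alpha+\Delta\lambda)v_\Delta$, $N_\lambda v_\Delta=\beta v_\Delta$, $M_\lambda v_\Delta=Y_\lambda v_\Delta=0$. Let $\alpha\in\mathbb{C}$ and $\Delta,\bar\Delta\in\mathbb{C}\setminus\{0\}$, and consider extensions of conformal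 $\widetilde{\mathrm{SV}}$-modules $$0\longrightarrow V(\alpha,0,\bar\Delta)\longrightarrow E\longrightarrow V(\alpha,0,\Delta)\longrightarrow 0.$$ Two extensions are equivalent if there is a module homomorphism between the middle terms inducing the identity on both ends; an extension is trivial if it is equivalent to the direct sum. An extension is said to be given by polynomials $f,g,h,k\in\mathbb{C}[\partial,\lambda]$ if the generator $v_\Delta$ of the quotient has a lift to $E$, again denoted $v_\Delta$, with $$L_\lambda v_\Delta=(\partial+\alpha+\Delta\lambda)v_\Delta+f(\partial,\lambda)v_{\bar\Delta},\quad M_\lambda v_\Delta=g(\partial,\lambda)v_{\bar\Delta},\quad Y_\lambda v_\Delta=h(\partial,\lambda)v_{\bar\Delta},\quad N_\lambda v_\Delta=k(\partial,\lambda)v_{\bar\Delta}.$$ Nontrivial extensions exist only if $\Delta-\bar\Delta\in\{0,1,2,3,4,5,6\}$. Every nontrivial extension is given by some polynomials from the following list. Conversely, for each $(f,g,h,k)$ in the list there is an extension given by it, this extension is unique up to equivalence, and it is nontrivial. In the list $g=h=0$ throughout, $\bar\partial=\partial+\alpha$, and the letters $a_i,c_i$ are complex constants. (i) $\Delta=\bar\Delta$: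 $f=c_0+c_1\lambda$, $k=a_0$, with $(c_0,c_1,a_0)\ne(0,0,0)$. (ii) $\Delta-\bar\Delta=1$: $f=0$, $k=a_1\lambda$, with $a_1\ne0$. (iii) $\Delta-\bar\Delta=2$: $f=c_2\lambda^2(2\bar\partial+\lambda)$, $k=a_2\lambda(\bar\partial-\bar\Delta\lambda)$, with $(c_2,a_2)\ne(0,0)$. (iv) $(\Delta,\bar\Delta)=(1,-2)$: $f=c_3\bar\partial\lambda^2(\bar\partial+\lambda)$, $k=a_3\lambda(\bar\partial^2+3\bar\partial\lambda+2\lambda^2)$, with $(c_3,a_3)\ne(0,0)$. (iv') $\Delta-\bar\Delta=3$, $\bar\Delta\ne-2$: $f=c_3\bar\partial\lambda^2(\bar\partial+\lambda)$, $k=0$, with $c_3\ne0$. (v) $\Delta-\bar\Delta=4$: $f=c_5\lambda^2(4\bar\partial^3+6\bar\partial^2\lambda-\bar\partial\lambda^2+\bar\Delta\lambda^3)$, $k=0$, with $c_5\ne0$. (vi) $(\Delta,\bar\Delta)=(1,-4)$: $f=c_6(\bar\partial^4\lambda^2-10\bar\partial^2\lambda^4-17\bar\partial\lambda^5-8\lambda^6)$,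 $k=0$, with $c_6\ne0$. (vii) $(\Delta,\bar\Delta)=\left(\tfrac72\pm\tfrac{\sqrt{19}}2,-\tfrac52\pm\tfrac{\sqrt{19}}2\right)$ (the same sign in both): $f=c_7\big(\bar\partial^4\lambda^3-(2\bar\Delta+3)\bar\partial^3\lambda^4-3\bar\Delta\bar\partial^2\lambda^5-(3\bar\Delta+1)\bar\partial\lambda^6-(\bar\Delta+\tfrac9{28})\lambda^7\big)$, $k=0$, with $c_7\ne0$. -/

import Mathlib

open Polynomial

universe u v w x y

/-- `PolynomialFamily φ` : the `V`-valued function `λ ↦ φ λ` is (the evaluation of) an element of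
`ℂ[λ] ⊗ V`.  As `ℂ` is infinite, that element is determined by the function, and an identity
between such elements is the same as an identity for all `λ ∈ ℂ` (and all `λ, μ ∈ ℂ` in two
variables). -/
def PolynomialFamily {V : Type u} [AddCommGroup V] [Module ℂ V] (φ : ℂ → V) : Prop :=
  ∃ c : ℕ →₀ V, ∀ l : ℂ, φ l = c.sum fun n x => l ^ n • x

/-- `IsReflection D φ ψ` : `φ λ = ∑ λⁿ cₙ` is polynomial in `λ`, and `ψ λ = ∑ (-λ - D)ⁿ cₙ` is what
results from replacing `λ` by `-λ - D`, the powers of the operator being put on the left of the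
coefficients. -/
def IsReflection {V : Type u} [AddCommGroup V] [Module ℂ V] (D : V →ₗ[ℂ] V) (φ ψ : ℂ → V) : Prop :=
  ∃ c : ℕ →₀ V, (∀ l : ℂ, φ l = c.sum fun n x => l ^ n • x) ∧
    ∀ l : ℂ, ψ l = c.sum fun n x => ((-(l • (1 : Module.End ℂ V)) - D) ^ n) x

/-- A Lie conformal algebra structure on a complex vector space `R`.  The `ℂ[∂]`-module structure
is given by the operator `D` (the action of `∂`), and `bracket l a b` is `[a_λ b]` at `λ = l`. -/
structure LieConformalAlgebra (R : Type u) [AddCommGroup R] [Module ℂ R] where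
  D : R →ₗ[ℂ] R
  bracket : ℂ → R →ₗ[ℂ] R →ₗ[ℂ] R
  polynomial : ∀ a b, PolynomialFamily fun l => bracket l a b
  bracket_D_left : ∀ l a b, bracket l (D a) b = -l • bracket l a b
  bracket_D_right : ∀ l a b, bracket l a (D b) = D (bracket l a b) + l • bracket l a b
  skew : ∀ a b, IsReflection D (fun l => bracket l b a) (fun l => -bracket l a b)
  jacobi : ∀ l m a b c, bracket l a (bracket m b c) =
    bracket (l + m) (bracket l a b) c + bracket m b (bracket l a c)

/-- A conformal module over a Lie conformal algebra: `D` is the action of `∂` and `act l a x` is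
`a_λ x` at `λ = l`, which is an element of `ℂ[λ] ⊗ V` for all `a` and `x`. -/
structure ConformalModule {R : Type u} [AddCommGroup R] [Module ℂ R] (A : LieConformalAlgebra R)
    (V : Type v) [AddCommGroup V] [Module ℂ V] where
  D : V →ₗ[ℂ] V
  act : ℂ → R →ₗ[ℂ] V →ₗ[ℂ] V
  polynomial : ∀ a x, PolynomialFamily fun l => act l a x
  act_bracket : ∀ l m a b x,
    act l a (act m b x) - act m b (act l a x) = act (l + m) (A.bracket l a b) x
  act_D : ∀ l a x, act l (A.D a) x = -l • act l a x
  D_act : ∀ l a x, D (act l a x) - act l a (D x) = -l • act l a x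

namespace ConformalModule

variable {R : Type u} [AddCommGroup R] [Module ℂ R] {A : LieConformalAlgebra R}
  {V : Type v} [AddCommGroup V] [Module ℂ V] {W : Type w} [AddCommGroup W] [Module ℂ W]

/-- Homomorphisms of conformal modules: `ℂ[∂]`-linear maps commuting with the action. -/
def IsHom (S : ConformalModule A V) (T : ConformalModule A W) (ψ : V →ₗ[ℂ] W) : Prop :=
  (∀ x, ψ (S.D x) = T.D (ψ x)) ∧ ∀ l a x, ψ (S.act l a x) = T.act l a (ψ x)

end ConformalModule

theorem PolynomialFamily.add {V : Type u} [AddCommGroup V] [Module ℂ V] {φ ψ : ℂ → V}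
    (hφ : PolynomialFamily φ) (hψ : PolynomialFamily ψ) :
    PolynomialFamily fun l => φ l + ψ l := by
  obtain ⟨c, hc⟩ := hφ
  obtain ⟨d, hd⟩ := hψ
  refine ⟨c + d, fun l => ?_⟩
  simp only [hc, hd]
  rw [Finsupp.sum_add_index'] <;> simp

theorem PolynomialFamily.map {V : Type u} [AddCommGroup V] [Module ℂ V] {W : Type v}
    [AddCommGroup W] [Module ℂ W] {φ : ℂ → V} (hφ : PolynomialFamily φ) (F : V →ₗ[ℂ] W) :
    PolynomialFamily fun l => F (φ l) := by
  obtain ⟨c, hc⟩ := hφ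
  refine ⟨c.mapRange F F.map_zero, fun l => ?_⟩
  simp only [hc]
  rw [Finsupp.sum_mapRange_index (by simp), Finsupp.sum, map_sum, Finsupp.sum]
  simp

namespace ConformalModule

variable {R : Type u} [AddCommGroup R] [Module ℂ R] {A : LieConformalAlgebra R}
  {V : Type v} [AddCommGroup V] [Module ℂ V] {W : Type w} [AddCommGroup W] [Module ℂ W]

/-- The direct sum of two conformal modules. -/
def prod (S : ConformalModule A V) (T : ConformalModule A W) : ConformalModule A (V × W) where
  D := S.D.prodMap T.D
  act l := LinearMap.mk₂ ℂ (fun a x => (S.act l a x.1, T.act l a x.2))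
    (by intros; simp) (by intros; simp) (by intros; simp) (by intros; simp)
  polynomial a x := by
    have h := ((S.polynomial a x.1).map (LinearMap.inl ℂ V W)).add
      ((T.polynomial a x.2).map (LinearMap.inr ℂ V W))
    simpa using h
  act_bracket l m a b x := by
    simp [S.act_bracket, T.act_bracket]
  act_D l a x := by simp [S.act_D, T.act_D]
  D_act l a x := by
    have h := S.D_act l a x.1
    have h' := T.D_act l a x.2
    simpa using And.intro h h'

/-- An extension `0 → V → E → W → 0` of the conformal module `T` on `W` by the conformal module
`S` on `V`. -/
structure Extension (S : ConformalModule A V) (T : ConformalModule A W) where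
  carrier : Type x
  [addCommGroup : AddCommGroup carrier]
  [module : Module ℂ carrier]
  str : ConformalModule A carrier
  i : V →ₗ[ℂ] carrier
  p : carrier →ₗ[ℂ] W
  i_isHom : S.IsHom str i
  p_isHom : str.IsHom T p
  injective : Function.Injective i
  exact : Function.Exact i p
  surjective : Function.Surjective p

attribute [instance] Extension.addCommGroup Extension.module

namespace Extension

variable {S : ConformalModule A V} {T : ConformalModule A W}

/-- Equivalence of extensions: a module homomorphism `ψ : E → E'` that induces the identity on
both ends. -/
def Equivalent (E : Extension.{u, v, w, x} S T) (E' : Extension.{u, v, w, y} S T) : Prop :=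
  ∃ ψ : E.carrier →ₗ[ℂ] E'.carrier, E.str.IsHom E'.str ψ ∧
    (∀ x, ψ (E.i x) = E'.i x) ∧ ∀ x, E'.p (ψ x) = E.p x

/-- The extension given by the direct sum. -/
def split (S : ConformalModule A V) (T : ConformalModule A W) : Extension S T where
  carrier := V × W
  str := S.prod T
  i := LinearMap.inl ℂ V W
  p := LinearMap.snd ℂ V W
  i_isHom := by constructor <;> intros <;> simp [ConformalModule.prod]
  p_isHom := by constructor <;> intros <;> simp [ConformalModule.prod]
  injective := LinearMap.inl_injective
  exact := by
    rintro ⟨x, y⟩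
    simp [eq_comm]
  surjective := LinearMap.snd_surjective

/-- An extension is trivial if it is equivalent to the direct sum. -/
def IsTrivial (E : Extension S T) : Prop := E.Equivalent (split S T)

end Extension

end ConformalModule

/-! The extended Schrödinger-Virasoro conformal algebra. -/

/-- The four generators. -/
inductive SVGen where
  | L | M | Y | N

instance : DecidableEq SVGen := fun a b => by
  cases a <;> cases b <;> first | exact isTrue rfl | exact isFalse (fun h => by cases h)

instance : Fintype SVGen := ⟨{.L, .M, .Y, .N}, fun a => by cases a <;> simp⟩

/-- The free `ℂ[∂]`-module `ℂ[∂]L ⊕ ℂ[∂]M ⊕ ℂ[∂]Y ⊕ ℂ[∂]N`; the variable `X` is `∂`. -/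
abbrev SVCarrier : Type := SVGen → ℂ[X]

/-- The generator `s` as an element of the algebra. -/
noncomputable def svGen (s : SVGen) : SVCarrier := Pi.single s 1

/-- The `λ`-brackets of the generators, at `λ = l`. -/
noncomputable def svTable (l : ℂ) : SVGen → SVGen → SVCarrier
  | .L, .L => (X + C (2 * l)) • svGen .L
  | .L, .Y => (X + C (3 / 2 * l)) • svGen .Y
  | .L, .M => (X + C l) • svGen .M
  | .L, .N => (X + C l) • svGen .N
  | .Y, .Y => (X + C (2 * l)) • svGen .M
  | .N, .M => (2 : ℂ[X]) • svGen .M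
  | .N, .Y => (1 : ℂ[X]) • svGen .Y
  | .Y, .L => (C (1 / 2) * X + C (3 / 2 * l)) • svGen .Y
  | .M, .L => C l • svGen .M
  | .N, .L => C l • svGen .N
  | .M, .N => (-2 : ℂ[X]) • svGen .M
  | .Y, .N => (-1 : ℂ[X]) • svGen .Y
  | .M, .M => 0
  | .M, .Y => 0
  | .Y, .M => 0
  | .N, .N => 0

/-- The sesquilinear extension of the table:
`[(∑ aᵢ(∂) eᵢ)_λ (∑ bⱼ(∂) eⱼ)] = ∑ aᵢ(-λ) bⱼ(∂ + λ) [eᵢ_λ eⱼ]`. -/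
noncomputable def svBracket (l : ℂ) (a b : SVCarrier) : SVCarrier :=
  ∑ s : SVGen, ∑ t : SVGen, (C ((a s).eval (-l)) * (b t).comp (X + C l)) • svTable l s t

/-- Multiplication by `∂` on the free module. -/
noncomputable def svD : SVCarrier →ₗ[ℂ] SVCarrier where
  toFun a := (X : ℂ[X]) • a
  map_add' a b := smul_add _ a b
  map_smul' c a := smul_comm _ c a

theorem IsReflection.add {V : Type u} [AddCommGroup V] [Module ℂ V] {D : V →ₗ[ℂ] V}
    {φ ψ φ' ψ' : ℂ → V} (h : IsReflection D φ ψ) (h' : IsReflection D φ' ψ') :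
    IsReflection D (fun l => φ l + φ' l) (fun l => ψ l + ψ' l) := by
  obtain ⟨c, hc, hc'⟩ := h
  obtain ⟨d, hd, hd'⟩ := h'
  refine ⟨c + d, fun l => ?_, fun l => ?_⟩
  · simp only [hc, hd]
    rw [Finsupp.sum_add_index'] <;> simp
  · simp only [hc', hd']
    rw [Finsupp.sum_add_index'] <;> simp

theorem IsReflection.sum {V : Type u} [AddCommGroup V] [Module ℂ V] {D : V →ₗ[ℂ] V}
    {ι : Type v} (s : Finset ι) {φ ψ : ι → ℂ → V} (h : ∀ j, IsReflection D (φ j) (ψ j)) :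
    IsReflection D (fun l => ∑ j ∈ s, φ j l) (fun l => ∑ j ∈ s, ψ j l) := by
  classical
  induction s using Finset.induction_on with
  | empty => exact ⟨0, by simp, by simp⟩
  | insert j s hj ih => simpa [Finset.sum_insert hj] using (h j).add ih

theorem svC_smul (c : ℂ) (a : SVCarrier) : (C c : ℂ[X]) • a = c • a := by
  funext s
  simp [smul_eq_C_mul]

theorem svReflection_gen (P : ℂ[X][X]) (r : SVGen) :
    IsReflection svD (fun l => P.eval (C l) • svGen r)
      (fun l => P.eval (-C l - X) • svGen r) := by
  induction P using Polynomial.induction_on' with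
  | add P Q hP hQ => simpa [add_smul] using hP.add hQ
  | monomial n p =>
    refine ⟨Finsupp.single n (p • svGen r), fun l => ?_, fun l => ?_⟩
    · rw [Finsupp.sum_single_index (by simp)]
      simp only [eval_monomial, ← C_pow]
      rw [mul_comm, mul_smul, svC_smul]
    · rw [Finsupp.sum_single_index (by simp)]
      simp only [eval_monomial]
      induction n with
      | zero => simp
      | succ n ih =>
        rw [pow_succ' _ n, pow_succ' _ n, Module.End.mul_apply, ← ih]
        simp only [LinearMap.sub_apply, LinearMap.neg_apply, LinearMap.smul_apply,
          Module.End.one_apply, svD, LinearMap.coe_mk, AddHom.coe_mk, ← svC_smul, ← mul_smul,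
          ← neg_smul, ← sub_smul]
        congr 1
        ring

theorem sv_eval_eval₂ (p : ℂ[X]) (q : ℂ[X][X]) (z : ℂ[X]) :
    (p.eval₂ (C.comp C) q).eval z = p.comp (q.eval z) := by
  induction p using Polynomial.induction_on' with
  | add p p' h h' => simp [h, h']
  | monomial n c => simp [eval₂_monomial]

theorem svReflection (p q : ℂ[X]) (Q : ℂ[X][X]) (r : SVGen) :
    IsReflection svD (fun l => (C (p.eval (-l)) * q.comp (X + C l)) • Q.eval (C l) • svGen r)
      (fun l => (C (q.eval (-l)) * p.comp (X + C l)) • Q.eval (-C l - X) • svGen r) := by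
  have hc : ∀ (p : ℂ[X]) (l : ℂ), p.comp (-C l) = C (p.eval (-l)) := by
    intro p l
    rw [← C_neg, comp_C]
  convert svReflection_gen
    (p.eval₂ (C.comp C) (-X) * q.eval₂ (C.comp C) (C X + X) * Q) r using 2 with l l
  · rw [← mul_smul]
    congr 1
    simp only [eval_mul, sv_eval_eval₂, eval_neg, eval_add, eval_X, eval_C, hc]
  · rw [← mul_smul]
    congr 1
    simp only [eval_mul, sv_eval_eval₂, eval_neg, eval_add, eval_X, eval_C]
    rw [show -(-C l - X) = (X + C l : ℂ[X]) by ring, show X + (-C l - X) = (-C l : ℂ[X]) by ring,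
      hc]
    ring

/-- `svBracket l` as a bilinear map. -/
noncomputable def svBilin (l : ℂ) : SVCarrier →ₗ[ℂ] SVCarrier →ₗ[ℂ] SVCarrier :=
  LinearMap.mk₂ ℂ (svBracket l)
    (by
      intro a a' b
      unfold svBracket
      simp only [Pi.add_apply, eval_add, C_add, add_mul, add_smul,
        Finset.sum_add_distrib])
    (by
      intro c a b
      unfold svBracket
      simp only [Pi.smul_apply, eval_smul, smul_eq_mul, C_mul, mul_assoc,
        mul_smul (C c : ℂ[X]), ← Finset.smul_sum, svC_smul])
    (by
      intro a b b'
      unfold svBracket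
      simp only [Pi.add_apply, add_comp, mul_add, add_smul, Finset.sum_add_distrib])
    (by
      intro c a b
      unfold svBracket
      simp only [Pi.smul_apply, smul_comp, mul_smul_comm, smul_assoc,
        ← Finset.smul_sum])

theorem svBilin_apply (l : ℂ) (a b : SVCarrier) : svBilin l a b = svBracket l a b := rfl

theorem svGen_sum {V : Type*} [AddCommMonoid V] (f : SVGen → V) :
    ∑ s, f s = f .L + (f .M + (f .Y + f .N)) := by
  have h : (Finset.univ : Finset SVGen) = {.L, .M, .Y, .N} := rfl
  rw [h, Finset.sum_insert (by simp), Finset.sum_insert (by simp), Finset.sum_insert (by simp),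
    Finset.sum_singleton]

theorem svTable_skew (s t : SVGen) : ∃ (Q : ℂ[X][X]) (r : SVGen), ∀ l,
    svTable l t s = Q.eval (C l) • svGen r ∧ -svTable l s t = Q.eval (-C l - X) • svGen r := by
  have h : ∀ {r : SVGen} {x y : ℂ[X]}, -x = y → -(x • svGen r) = y • svGen r := by
    rintro r x y rfl
    rw [neg_smul]
  have hr : ∀ {r : SVGen} {x y : ℂ[X]}, x = y → x • svGen r = y • svGen r := by
    rintro r x y rfl
    rfl
  have e' : (C (3 / 2) : ℂ[X]) = 1 + C (1 / 2) := by
    rw [← C_1, ← C_add]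
    norm_num
  have h2 : (C 2 : ℂ[X]) = 2 := rfl
  cases s <;> cases t <;> simp only [svTable]
  · exact ⟨C X + 2 * X, .L, fun l => ⟨hr (by simp [h2]), h (by simp [h2]; ring)⟩⟩
  · exact ⟨X, .M, fun l => ⟨hr (by simp), h (by simp; ring)⟩⟩
  · exact ⟨C (C (1 / 2) * X) + C (C (3 / 2)) * X, .Y, fun l => ⟨hr (by simp), h (by simp [-one_div]; linear_combination X * e')⟩⟩
  · exact ⟨X, .N, fun l => ⟨hr (by simp), h (by simp; ring)⟩⟩
  · exact ⟨C X + X, .M, fun l => ⟨hr (by simp), h (by simp)⟩⟩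
  · exact ⟨0, .L, fun l => ⟨by simp, by simp⟩⟩
  · exact ⟨0, .L, fun l => ⟨by simp, by simp⟩⟩
  · exact ⟨C (C 2), .M, fun l => ⟨hr (by simp [h2]), h (by simp [h2])⟩⟩
  · exact ⟨C X + C (C (3 / 2)) * X, .Y, fun l => ⟨hr (by simp), h (by simp [-one_div]; linear_combination X * e')⟩⟩
  · exact ⟨0, .L, fun l => ⟨by simp, by simp⟩⟩
  · exact ⟨C X + 2 * X, .M, fun l => ⟨hr (by simp [h2]), h (by simp [h2]; ring)⟩⟩
  · exact ⟨1, .Y, fun l => ⟨hr (by simp), h (by simp)⟩⟩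
  · exact ⟨C X + X, .N, fun l => ⟨hr (by simp), h (by simp)⟩⟩
  · exact ⟨C (C (-2)), .M, fun l => ⟨hr (by simp [h2]), h (by simp [h2])⟩⟩
  · exact ⟨C (C (-1)), .Y, fun l => ⟨hr (by simp), h (by simp)⟩⟩
  · exact ⟨0, .L, fun l => ⟨by simp, by simp⟩⟩

theorem svJacobi (l m : ℂ) (a b c : SVCarrier) : svBracket l a (svBracket m b c) =
    svBracket (l + m) (svBracket l a b) c + svBracket m b (svBracket l a c) := by
  have hL : ∀ l a b, svBracket l a b .L =
    C ((a .L).eval (-l)) * (b .L).comp (X + C l) * (X + C (2 * l)) := by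
    intro l a b
    simp [svBracket, svGen_sum, svTable, svGen]
  have hY : ∀ l a b, svBracket l a b .Y = 
      C ((a .L).eval (-l)) * (b .Y).comp (X + C l) * (X + C (3 / 2 * l))
      + C ((a .Y).eval (-l)) * (b .L).comp (X + C l) * (C (1 / 2) * X + C (3 / 2 * l))
      + C ((a .N).eval (-l)) * (b .Y).comp (X + C l) 
      - C ((a .Y).eval (-l)) * (b .N).comp (X + C l) := by
    intro l a b
    simp [svBracket, svGen_sum, svTable, svGen]
    ring
  have hN : ∀ l a b, svBracket l a b .N = 
      C ((a .L).eval (-l)) * (b .N).comp (X + C l) * (X + C l)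
      + C ((a .N).eval (-l)) * (b .L).comp (X + C l) * C l := by
    intro l a b
    simp [svBracket, svGen_sum, svTable, svGen]
  have hM : ∀ l a b, svBracket l a b .M = 
      C ((a .L).eval (-l)) * (b .M).comp (X + C l) * (X + C l)
      + C ((a .M).eval (-l)) * (b .L).comp (X + C l) * C l
      + C ((a .Y).eval (-l)) * (b .Y).comp (X + C l) * (X + C (2 * l))
      + C 2 * C ((a .N).eval (-l)) * (b .M).comp (X + C l)
      - C 2 * C ((a .M).eval (-l)) * (b .N).comp (X + C l) := by
    intro l a b
    have e2 : (C 2 : ℂ[X]) = 2 := rfl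
    rw [e2]
    simp [svBracket, svGen_sum, svTable, svGen]
    ring
  obtain ⟨z, hz⟩ : ∃ z : ℂ[X], X + C (l + m) = z := ⟨_, rfl⟩
  have h1 : ∀ p : ℂ[X], (p.comp (X + C m)).comp (X + C l) = p.comp z := by
    intro p
    rw [comp_assoc, ← hz]
    simp [add_assoc]
  have h2 : ∀ p : ℂ[X], (p.comp (X + C l)).comp (X + C m) = p.comp z := by
    intro p
    rw [comp_assoc, ← hz]
    simp [add_assoc, add_comm (C m)]
  have h3 : ∀ p : ℂ[X], (p.comp (X + C l)).eval (-(l + m)) = p.eval (-m) := by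
    intro p
    rw [eval_comp]
    simp
  funext r
  refine Polynomial.funext fun x => ?_
  have hz' : z.eval x = x + (l + m) := by simp [← hz]
  cases r <;>
    simp only [Pi.add_apply, hL, hM, hY, hN, mul_comp, add_comp, sub_comp, X_comp, C_comp,
      eval_mul, eval_add, eval_sub, eval_X, eval_C, h1, h2, h3, hz, hz'] <;>
    ring

theorem PolynomialFamily.of_isReflection {V : Type u} [AddCommGroup V] [Module ℂ V]
    {D : V →ₗ[ℂ] V} {φ ψ : ℂ → V} (h : IsReflection D φ ψ) : PolynomialFamily φ :=
  ⟨h.choose, h.choose_spec.1⟩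

theorem svSkew (a b : SVCarrier) :
    IsReflection svD (fun l => svBracket l b a) (fun l => -svBracket l a b) := by
  unfold svBracket
  rw [show (fun l => -∑ s : SVGen, ∑ t : SVGen,
    (C ((a s).eval (-l)) * (b t).comp (X + C l)) • svTable l s t) =
    (fun l => ∑ t : SVGen, ∑ s : SVGen,
    (C ((a s).eval (-l)) * (b t).comp (X + C l)) • (-svTable l s t)) from by
      funext l
      rw [Finset.sum_comm]
      simp only [smul_neg, Finset.sum_neg_distrib]]
  refine IsReflection.sum _ fun t => IsReflection.sum _ fun s => ?_
  obtain ⟨Q, r, h⟩ := svTable_skew s t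
  simp only [fun l => (h l).1, fun l => (h l).2]
  exact svReflection _ _ Q r

theorem svBracket_D_left (l : ℂ) (a b : SVCarrier) :
    svBracket l ((X : ℂ[X]) • a) b = -l • svBracket l a b := by
  unfold svBracket
  simp only [Pi.smul_apply, smul_eq_mul, eval_mul, eval_X, C_mul, mul_assoc,
    mul_smul (C (-l) : ℂ[X]), ← Finset.smul_sum, svC_smul]

theorem svBracket_D_right (l : ℂ) (a b : SVCarrier) :
    svBracket l a ((X : ℂ[X]) • b) = (X : ℂ[X]) • svBracket l a b + l • svBracket l a b := by
  rw [← svC_smul, ← add_smul]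
  unfold svBracket
  rw [Finset.smul_sum]
  refine Finset.sum_congr rfl fun s _ => ?_
  rw [Finset.smul_sum]
  refine Finset.sum_congr rfl fun t _ => ?_
  rw [← mul_smul]
  congr 1
  rw [Pi.smul_apply, smul_eq_mul, mul_comp, X_comp]
  ring

/-- The extended Schrödinger-Virasoro conformal algebra. -/
noncomputable def svAlgebra : LieConformalAlgebra SVCarrier where
  D := svD
  bracket := svBilin
  polynomial a b := .of_isReflection (svSkew b a)
  bracket_D_left := svBracket_D_left
  bracket_D_right := svBracket_D_right
  skew := svSkew
  jacobi := svJacobi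

/-- The coefficient of `v` in `s_λ v`, for a generator `s` of the algebra and the generator `v` of
the module `V(α, β, Δ)`, at `λ = l`. -/
noncomputable def svCoeff (α β Δ l : ℂ) : SVGen → ℂ[X]
  | .L => X + C α + C (Δ * l)
  | .N => C β
  | .M => 0
  | .Y => 0

/-- The action on `V(α, β, Δ) = ℂ[∂]v`, where `p(∂)v` is represented by the polynomial `p`:
`(∑ aᵢ(∂) eᵢ)_λ (p(∂) v) = ∑ aᵢ(-λ) p(∂ + λ) (eᵢ_λ v)`. -/
noncomputable def svAct (α β Δ l : ℂ) (a : SVCarrier) (p : ℂ[X]) : ℂ[X] :=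
  ∑ s : SVGen, C ((a s).eval (-l)) * p.comp (X + C l) * svCoeff α β Δ l s

theorem svAct_eq (α β Δ l : ℂ) (a : SVCarrier) (p : ℂ[X]) : svAct α β Δ l a p =
    p.comp (X + C l) * (C ((a .L).eval (-l)) * (X + C α + C (Δ * l)) +
      C ((a .N).eval (-l)) * C β) := by
  unfold svAct
  rw [svGen_sum]
  simp only [svCoeff]
  ring

theorem svAct_D_left (α β Δ l : ℂ) (a : SVCarrier) (p : ℂ[X]) :
    svAct α β Δ l ((X : ℂ[X]) • a) p = -l • svAct α β Δ l a p := by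
  rw [svAct_eq, svAct_eq, smul_eq_C_mul]
  simp only [Pi.smul_apply, smul_eq_mul, eval_mul, eval_X, C_mul]
  ring

theorem svAct_D_right (α β Δ l : ℂ) (a : SVCarrier) (p : ℂ[X]) :
    X * svAct α β Δ l a p - svAct α β Δ l a (X * p) = -l • svAct α β Δ l a p := by
  rw [svAct_eq, svAct_eq, smul_eq_C_mul, mul_comp, X_comp, C_neg]
  ring

theorem svAct_bracket (α β Δ l m : ℂ) (a b : SVCarrier) (p : ℂ[X]) :
    svAct α β Δ l a (svAct α β Δ m b p) - svAct α β Δ m b (svAct α β Δ l a p) =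
      svAct α β Δ (l + m) (svBracket l a b) p := by
  have hL : svBracket l a b .L =
      C ((a .L).eval (-l)) * (b .L).comp (X + C l) * (X + C (2 * l)) := by
    simp [svBracket, svGen_sum, svTable, svGen]
  have hN : svBracket l a b .N =
      C ((a .L).eval (-l)) * (b .N).comp (X + C l) * (X + C l)
      + C ((a .N).eval (-l)) * (b .L).comp (X + C l) * C l := by
    simp [svBracket, svGen_sum, svTable, svGen]
  obtain ⟨z, hz⟩ : ∃ z : ℂ[X], X + C (l + m) = z := ⟨_, rfl⟩
  have h1 : ∀ p : ℂ[X], (p.comp (X + C m)).comp (X + C l) = p.comp z := by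
    intro p
    rw [comp_assoc, ← hz]
    simp [add_assoc]
  have h2 : ∀ p : ℂ[X], (p.comp (X + C l)).comp (X + C m) = p.comp z := by
    intro p
    rw [comp_assoc, ← hz]
    simp [add_assoc, add_comm (C m)]
  have h3 : ∀ p : ℂ[X], (p.comp (X + C l)).eval (-(l + m)) = p.eval (-m) := by
    intro p
    rw [eval_comp]
    simp
  refine Polynomial.funext fun x => ?_
  simp only [svAct_eq, hL, hN, mul_comp, add_comp, X_comp, C_comp, eval_sub, eval_mul, eval_add,
    eval_X, eval_C, h1, h2, h3, hz]
  ring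

theorem svAct_polynomial (α β Δ : ℂ) (a : SVCarrier) (p : ℂ[X]) :
    PolynomialFamily fun l => svAct α β Δ l a p := by
  have key : ∀ P : ℂ[X][X], PolynomialFamily fun l => P.eval (C l) := by
    intro P
    induction P using Polynomial.induction_on' with
    | add P Q hP hQ => simpa using hP.add hQ
    | monomial n q =>
      refine ⟨Finsupp.single n q, fun l => ?_⟩
      simp only [eval_monomial]
      rw [Finsupp.sum_single_index (by simp), ← C_pow, smul_eq_C_mul, mul_comm]
  have hc : ∀ (p : ℂ[X]) (l : ℂ), p.comp (-C l) = C (p.eval (-l)) := by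
    intro p l
    rw [← C_neg, comp_C]
  convert key (p.eval₂ (C.comp C) (C X + X) *
    ((a .L).eval₂ (C.comp C) (-X) * (C X + C (C α) + C (C Δ) * X) +
      (a .N).eval₂ (C.comp C) (-X) * C (C β))) using 2 with l
  rw [svAct_eq]
  simp only [eval_mul, eval_add, sv_eval_eval₂, eval_neg, eval_X, eval_C, hc, C_mul]

/-- The rank one conformal module `V(α, β, Δ)`, with `L_λ v = (∂ + α + Δ λ) v`, `N_λ v = β v` and
`M_λ v = Y_λ v = 0`, where `v = 1`. -/
noncomputable def svModule (α β Δ : ℂ) : ConformalModule svAlgebra ℂ[X] where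
  D := LinearMap.mulLeft ℂ X
  act l := LinearMap.mk₂ ℂ (svAct α β Δ l)
    (by
      intro a a' p
      unfold svAct
      simp only [Pi.add_apply, eval_add, C_add, add_mul, Finset.sum_add_distrib])
    (by
      intro c a p
      unfold svAct
      rw [smul_eq_C_mul, Finset.mul_sum]
      refine Finset.sum_congr rfl fun s _ => ?_
      rw [Pi.smul_apply, eval_smul, smul_eq_mul, C_mul]
      ring)
    (by
      intro a p p'
      unfold svAct
      simp only [add_comp, mul_add, add_mul, Finset.sum_add_distrib])
    (by
      intro c a p
      unfold svAct
      simp only [smul_comp, mul_smul_comm, smul_mul_assoc, ← Finset.smul_sum])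
  polynomial a p := svAct_polynomial α β Δ a p
  act_bracket := svAct_bracket α β Δ
  act_D l a p := svAct_D_left α β Δ l a p
  D_act l a p := svAct_D_right α β Δ l a p

/-! Extensions of `V(α, β, Δ)` by `V(α', β', Δ')` in terms of cocycles. -/

/-- Polynomials `f(∂, λ) ∈ ℂ[∂, λ]`, as polynomials in `λ` with coefficients in `ℂ[∂]`. -/
abbrev BiPoly : Type := ℂ[X][X]

/-- The extension `E` is given by the polynomials `f, g, h, k`: there is `v` in `E`, lifting the
generator of `V(α, β, Δ)`, such that, with `v'` the image of the generator of `V(α', β', Δ')`,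
`L_λ v = (∂ + α + Δ λ) v + f(∂, λ) v'`, `M_λ v = g(∂, λ) v'`, `Y_λ v = h(∂, λ) v'` and
`N_λ v = β v + k(∂, λ) v'`.  (As a `ℂ[∂]`-module, `E` is then free on `v'` and `v`.) -/
def HasCocycle {α β Δ α' β' Δ' : ℂ}
    (E : ConformalModule.Extension (svModule α' β' Δ') (svModule α β Δ))
    (f g h k : BiPoly) : Prop :=
  ∃ v : E.carrier, E.p v = 1 ∧ ∀ l : ℂ,
    E.str.act l (svGen .L) v = E.str.D v + (α + Δ * l) • v + E.i (f.eval (C l)) ∧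
    E.str.act l (svGen .M) v = E.i (g.eval (C l)) ∧
    E.str.act l (svGen .Y) v = E.i (h.eval (C l)) ∧
    E.str.act l (svGen .N) v = β • v + E.i (k.eval (C l))

/-- The element `∂ + α` of `ℂ[∂, λ]`. -/
noncomputable def biD (α : ℂ) : BiPoly := C (X + C α)

/-- The element `λ` of `ℂ[∂, λ]`. -/
noncomputable def biL : BiPoly := X

/-- Constants in `ℂ[∂, λ]`. -/
noncomputable def biC (z : ℂ) : BiPoly := C (C z)

/-- The list of cocycles `(f, g, h, k)` for extensions of `V(α, 0, Δ)` by `V(α, 0, Δ')`. -/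
inductive IsListedCocycle (α Δ Δ' : ℂ) : BiPoly → BiPoly → BiPoly → BiPoly → Prop
  | diff_zero (c₀ c₁ a₀ : ℂ) (hΔ : Δ = Δ') (hne : (c₀, c₁, a₀) ≠ (0, 0, 0)) :
      IsListedCocycle α Δ Δ' (biC c₀ + biC c₁ * biL) 0 0 (biC a₀)
  | diff_one (a₁ : ℂ) (hΔ : Δ - Δ' = 1) (hne : a₁ ≠ 0) :
      IsListedCocycle α Δ Δ' 0 0 0 (biC a₁ * biL)
  | diff_two (c₂ a₂ : ℂ) (hΔ : Δ - Δ' = 2) (hne : (c₂, a₂) ≠ (0, 0)) :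
      IsListedCocycle α Δ Δ' (biC c₂ * (biL ^ 2 * (2 * biD α + biL))) 0 0
        (biC a₂ * (biL * (biD α - biC Δ' * biL)))
  | diff_three_special (c₃ a₃ : ℂ) (hΔ : (Δ, Δ') = (1, -2)) (hne : (c₃, a₃) ≠ (0, 0)) :
      IsListedCocycle α Δ Δ' (biC c₃ * (biD α * biL ^ 2 * (biD α + biL))) 0 0
        (biC a₃ * (biL * (biD α ^ 2 + 3 * biD α * biL + 2 * biL ^ 2)))
  | diff_three (c₃ : ℂ) (hΔ : Δ - Δ' = 3) (hΔ' : Δ' ≠ -2) (hne : c₃ ≠ 0) :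
      IsListedCocycle α Δ Δ' (biC c₃ * (biD α * biL ^ 2 * (biD α + biL))) 0 0 0
  | diff_four (c₅ : ℂ) (hΔ : Δ - Δ' = 4) (hne : c₅ ≠ 0) :
      IsListedCocycle α Δ Δ'
        (biC c₅ * (biL ^ 2 * (4 * biD α ^ 3 + 6 * biD α ^ 2 * biL - biD α * biL ^ 2 +
          biC Δ' * biL ^ 3))) 0 0 0
  | diff_five (c₆ : ℂ) (hΔ : (Δ, Δ') = (1, -4)) (hne : c₆ ≠ 0) :
      IsListedCocycle α Δ Δ'
        (biC c₆ * (biD α ^ 4 * biL ^ 2 - 10 * biD α ^ 2 * biL ^ 4 - 17 * biD α * biL ^ 5 -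
          8 * biL ^ 6)) 0 0 0
  | diff_six (c₇ : ℂ)
      (hΔ : (Δ, Δ') = (7 / 2 + ((√19 : ℝ) : ℂ) / 2, -5 / 2 + ((√19 : ℝ) : ℂ) / 2) ∨
        (Δ, Δ') = (7 / 2 - ((√19 : ℝ) : ℂ) / 2, -5 / 2 - ((√19 : ℝ) : ℂ) / 2)) (hne : c₇ ≠ 0) :
      IsListedCocycle α Δ Δ'
        (biC c₇ * (biD α ^ 4 * biL ^ 3 - biC (2 * Δ' + 3) * biD α ^ 3 * biL ^ 4 -
          biC (3 * Δ') * biD α ^ 2 * biL ^ 5 - biC (3 * Δ' + 1) * biD α * biL ^ 6 -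
          biC (Δ' + 9 / 28) * biL ^ 7)) 0 0 0

/-! Write `a = Δ`, `b = Δ'`, and rename `∂ + α` as `∂`. On both ends of the extension `N` acts by
zero because `β = 0`, and `M`, `Y` act by zero by definition. The relations `[N_λ M] = 2M` and `[N_λ
Y] = Y` therefore force `g = h = 0`. What remains decouples: `[L_λ L]` constrains `f` alone and
`[L_λ N]` constrains `k` alone. A new lift of the generator changes `f` by a coboundary `(∂ + bλ)
φ(∂ + λ) - (∂ + aλ) φ(∂)` and leaves `k` fixed. So extensions up to equivalence are pairs consisting
of the class of `f` and the polynomial `k`.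

Both conditions are identities in `∂, λ, μ` and are solved by comparing coefficients of `λ^q μ^r`.
For `k` (`cur_classification`), the terms linear in `λ` make it homogeneous of degree `n = a - b`.
The terms linear in `μ` express everything through the coefficient of `∂ⁿ⁻¹λ`, and those in `μ²`
leave only `n ≤ 2`, or `n = 3` with `b = -2`.

For `f` (`vir_normal_form`), a coboundary removes almost all of the coefficient of `λ`. What is left
is affine in `λ` if `a = b`. Otherwise it is zero unless `n = a - b` is a positive integer, and then
it is homogeneous of degree `n + 1` and divisible by `λ²`. The relations at `λ^q μ²` determine such
a cocycle by its coefficients `F₂`, `F₃` of `∂ⁿ⁻¹λ²`, `∂ⁿ⁻²λ³` (`IsVirNormal.eq_zero`). One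
direction in this plane is the coboundary of `∂ⁿ`, so there is at most one nontrivial class,
detected by the determinant `virDet`. The relation at `λ⁴μ³` (for `n ≥ 5`) multiplies `virDet` by a
quadratic in `n + 2b`. This singles out `b = -4` for `n = 5` and `b² + 5b + 3/2 = 0` for `n = 6`.
For `n ≥ 7` the relation at `λ⁵μ⁴` adds a quartic incompatible with the quadratic. Explicit
representatives with `virDet ≠ 0` realize the remaining cases. -/

/-- The value of `f(∂, λ)` at `∂ = x`, `λ = y`. -/
noncomputable def biEval (f : BiPoly) (x y : ℂ) : ℂ := (f.eval (C y)).eval x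

/-- Polynomials over a `ℂ`-algebra that agree at all complex numbers are equal. -/
theorem Polynomial.eq_of_eval_algebraMap_eq {S : Type*} [CommRing S] [IsDomain S] [Algebra ℂ S]
    {P Q : S[X]} (h : ∀ z : ℂ, P.eval (algebraMap ℂ S z) = Q.eval (algebraMap ℂ S z)) : P = Q := by
  refine eq_of_infinite_eval_eq P Q ?_
  refine Set.Infinite.mono ?_
    (Set.infinite_range_of_injective (FaithfulSMul.algebraMap_injective ℂ S))
  rintro _ ⟨z, rfl⟩
  exact h z

theorem BiPoly.ext_eval {f g : BiPoly} (h : ∀ y : ℂ, f.eval (C y) = g.eval (C y)) : f = g :=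
  Polynomial.eq_of_eval_algebraMap_eq h

theorem BiPoly.ext_biEval {f g : BiPoly} (h : ∀ x y, biEval f x y = biEval g x y) : f = g :=
  BiPoly.ext_eval fun y => Polynomial.funext fun x => h x y

/-! ### Polynomials in three variables and coefficients of substitutions -/

/-- Polynomials in `∂`, `λ`, `μ`; the outermost variable is `μ`, the innermost one is `∂`. -/
abbrev TriPoly : Type := ℂ[X][X][X]

namespace TriPoly

noncomputable def d : TriPoly := C (C X)

noncomputable def l : TriPoly := C X

noncomputable def m : TriPoly := X

noncomputable def const : ℂ →+* TriPoly := (C.comp C).comp C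

/-- The coefficient of `∂ᵖ λ^q μʳ`. -/
noncomputable def co (P : TriPoly) (p q r : ℕ) : ℂ := ((P.coeff r).coeff q).coeff p

/-- Evaluation at a point of `ℂ³`. -/
noncomputable def ev (x y z : ℂ) : TriPoly →+* ℂ :=
  (evalRingHom x).comp ((evalRingHom (C y)).comp (evalRingHom (C (C z))))

theorem ext_ev {P Q : TriPoly} (h : ∀ x y z, ev x y z P = ev x y z Q) : P = Q := by
  refine Polynomial.eq_of_eval_algebraMap_eq fun z => BiPoly.ext_biEval fun x y => ?_
  exact h x y z

/-- The substitution `f(u, v)`. -/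
noncomputable def sub (u v : TriPoly) : BiPoly →+* TriPoly :=
  eval₂RingHom (eval₂RingHom const u) v

theorem ev_sub (x y z : ℂ) (u v : TriPoly) (f : BiPoly) :
    ev x y z (sub u v f) = biEval f (ev x y z u) (ev x y z v) := by
  have : (ev x y z).comp (sub u v) =
      (evalRingHom (ev x y z u)).comp (evalRingHom (C (ev x y z v))) := by
    ext <;> simp [sub, ev, const]
  exact congrArg (fun F : BiPoly →+* ℂ => F f) this

@[simp] theorem ev_d (x y z : ℂ) : ev x y z d = x := by simp [ev, d]
@[simp] theorem ev_l (x y z : ℂ) : ev x y z l = y := by simp [ev, l]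
@[simp] theorem ev_m (x y z : ℂ) : ev x y z m = z := by simp [ev, m]
@[simp] theorem ev_const (x y z c : ℂ) : ev x y z (const c) = c := by simp [ev, const]

theorem co_add (P Q : TriPoly) (p q r : ℕ) : (P + Q).co p q r = P.co p q r + Q.co p q r := by
  simp [co]

theorem co_sub (P Q : TriPoly) (p q r : ℕ) : (P - Q).co p q r = P.co p q r - Q.co p q r := by
  simp [co]

theorem co_neg (P : TriPoly) (p q r : ℕ) : (-P).co p q r = -P.co p q r := by
  simp [co]

theorem co_const_mul (c : ℂ) (P : TriPoly) (p q r : ℕ) :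
    (const c * P).co p q r = c * P.co p q r := by
  simp [co, const]

theorem co_d_mul (P : TriPoly) (p q r : ℕ) :
    (d * P).co p q r = if p = 0 then 0 else P.co (p - 1) q r := by
  cases p <;> simp [co, d]

theorem co_l_mul (P : TriPoly) (p q r : ℕ) :
    (l * P).co p q r = if q = 0 then 0 else P.co p (q - 1) r := by
  cases q <;> simp [co, l]

theorem co_m_mul (P : TriPoly) (p q r : ℕ) :
    (m * P).co p q r = if r = 0 then 0 else P.co p q (r - 1) := by
  cases r <;> simp [co, m]

theorem co_monomial (c : ℂ) (i j k p q r : ℕ) :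
    (const c * (d ^ i * l ^ j * m ^ k)).co p q r = if p = i ∧ q = j ∧ r = k then c else 0 := by
  rw [co_const_mul]
  have : (d ^ i * l ^ j * m ^ k : TriPoly) = monomial k (monomial j (monomial i (1 : ℂ))) := by
    simp only [d, l, m, ← C_pow, ← C_mul, ← C_mul_X_pow_eq_monomial, C_1, one_mul]
  rw [this, co, coeff_monomial]
  by_cases h1 : k = r <;> by_cases h2 : j = q <;> by_cases h3 : i = p <;>
    simp [h1, h2, h3, coeff_monomial, eq_comm]

end TriPoly

open TriPoly

theorem BiPoly.induction_monomial {p : BiPoly → Prop} (f : BiPoly)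
    (add : ∀ f g, p f → p g → p (f + g))
    (mon : ∀ (j i : ℕ) (c : ℂ), p (monomial j (monomial i c))) : p f := by
  induction f using Polynomial.induction_on' with
  | add f g hf hg => exact add f g hf hg
  | monomial j a =>
    induction a using Polynomial.induction_on' with
    | add a b ha hb => rw [map_add]; exact add _ _ ha hb
    | monomial i c => exact mon j i c

namespace TriPoly

theorem sub_monomial (u v : TriPoly) (i j : ℕ) (c : ℂ) :
    sub u v (monomial j (monomial i c)) = const c * (u ^ i * v ^ j) := by
  simp [sub, mul_assoc]

theorem co_finset_sum {ι : Type*} (s : Finset ι) (F : ι → TriPoly) (p q r : ℕ) :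
    (∑ t ∈ s, F t).co p q r = ∑ t ∈ s, (F t).co p q r := by
  simp [co]

theorem co_sub_d_l (f : BiPoly) (p q r : ℕ) :
    (sub d l f).co p q r = if r = 0 then (f.coeff q).coeff p else 0 := by
  induction f using BiPoly.induction_monomial with
  | add f g hf hg => rw [map_add, co_add, hf, hg]; split <;> simp
  | mon j i c =>
    have := co_monomial c i j 0 p q r
    rw [pow_zero, mul_one] at this
    rw [sub_monomial, this]
    simp only [coeff_monomial]
    grind [coeff_monomial, coeff_zero]

theorem co_sub_d_m (f : BiPoly) (p q r : ℕ) :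
    (sub d m f).co p q r = if q = 0 then (f.coeff r).coeff p else 0 := by
  induction f using BiPoly.induction_monomial with
  | add f g hf hg => rw [map_add, co_add, hf, hg]; split <;> simp
  | mon j i c =>
    have := co_monomial c i 0 j p q r
    rw [pow_zero, mul_one] at this
    rw [sub_monomial, this]
    simp only [coeff_monomial]
    grind [coeff_monomial, coeff_zero]

theorem co_sub_d_add_m_l (f : BiPoly) (p q r : ℕ) :
    (sub (d + m) l f).co p q r = (p + r).choose r * (f.coeff q).coeff (p + r) := by
  induction f using BiPoly.induction_monomial with
  | add f g hf hg => rw [map_add, co_add, hf, hg]; simp; ring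
  | mon j i c =>
    have : const c * ((d + m) ^ i * l ^ j) = ∑ t ∈ Finset.range (i + 1),
        const (c * i.choose t) * (d ^ t * l ^ j * m ^ (i - t)) := by
      rw [add_pow d m i, Finset.sum_mul, Finset.mul_sum]
      refine Finset.sum_congr rfl fun t _ => ?_
      rw [map_mul, map_natCast]
      ring
    rw [sub_monomial, this, co_finset_sum]
    simp only [co_monomial]
    by_cases h : q = j ∧ p + r = i
    · obtain ⟨rfl, rfl⟩ := h
      rw [Finset.sum_eq_single p]
      · simp [Nat.choose_symm_add (a := p), mul_comm]
      · intro t _ ht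
        grind
      · intro hp
        simp at hp
    · rw [Finset.sum_eq_zero]
      · simp only [coeff_monomial]
        grind [coeff_monomial, coeff_zero]
      · intro t ht
        rw [Finset.mem_range] at ht
        grind

theorem co_sub_d_add_l_m (f : BiPoly) (p q r : ℕ) :
    (sub (d + l) m f).co p q r = (p + q).choose q * (f.coeff r).coeff (p + q) := by
  induction f using BiPoly.induction_monomial with
  | add f g hf hg => rw [map_add, co_add, hf, hg]; simp; ring
  | mon j i c =>
    have : const c * ((d + l) ^ i * m ^ j) = ∑ t ∈ Finset.range (i + 1),
        const (c * i.choose t) * (d ^ t * l ^ (i - t) * m ^ j) := by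
      rw [add_pow d l i, Finset.sum_mul, Finset.mul_sum]
      refine Finset.sum_congr rfl fun t _ => ?_
      rw [map_mul, map_natCast]
      ring
    rw [sub_monomial, this, co_finset_sum]
    simp only [co_monomial]
    by_cases h : r = j ∧ p + q = i
    · obtain ⟨rfl, rfl⟩ := h
      rw [Finset.sum_eq_single p]
      · simp [Nat.choose_symm_add (a := p), mul_comm]
      · intro t _ ht
        grind
      · intro hp
        simp at hp
    · rw [Finset.sum_eq_zero]
      · simp only [coeff_monomial]
        grind [coeff_monomial, coeff_zero]
      · intro t ht
        rw [Finset.mem_range] at ht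
        grind

theorem co_sub_d_l_add_m (f : BiPoly) (p q r : ℕ) :
    (sub d (l + m) f).co p q r = (q + r).choose q * (f.coeff (q + r)).coeff p := by
  induction f using BiPoly.induction_monomial with
  | add f g hf hg => rw [map_add, co_add, hf, hg]; simp; ring
  | mon j i c =>
    have : const c * (d ^ i * (l + m) ^ j) = ∑ t ∈ Finset.range (j + 1),
        const (c * j.choose t) * (d ^ i * l ^ t * m ^ (j - t)) := by
      rw [add_pow l m j, Finset.mul_sum, Finset.mul_sum]
      refine Finset.sum_congr rfl fun t _ => ?_
      rw [map_mul, map_natCast]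
      ring
    rw [sub_monomial, this, co_finset_sum]
    simp only [co_monomial]
    by_cases h : q + r = j ∧ p = i
    · obtain ⟨rfl, rfl⟩ := h
      rw [Finset.sum_eq_single q]
      · simp [mul_comm]
      · intro t _ ht
        grind
      · intro hp
        simp at hp
    · rw [Finset.sum_eq_zero]
      · simp only [coeff_monomial]
        grind [coeff_monomial, coeff_zero]
      · intro t ht
        rw [Finset.mem_range] at ht
        grind

end TriPoly

/-! ### Cocycle conditions and the relations they impose on coefficients -/

/-- The coboundary of `φ(∂)`. -/
def virCobdry (a b : ℂ) (φ : ℂ[X]) (x y : ℂ) : ℂ :=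
  (x + b * y) * φ.eval (x + y) - (x + a * y) * φ.eval x

/-- The condition that `[L_λ L] = (∂ + 2λ) L` imposes on `f`. -/
def IsVirCocycle (a b : ℂ) (F : ℂ → ℂ → ℂ) : Prop :=
  ∀ x l m : ℂ, (x + l + a * m) * F x l + (x + b * l) * F (x + l) m -
    (x + m + a * l) * F x m - (x + b * m) * F (x + m) l = (l - m) * F x (l + m)

/-- The condition that `[L_λ N] = (∂ + λ) N` imposes on `k`. -/
def IsCurCocycle (a b : ℂ) (F : ℂ → ℂ → ℂ) : Prop :=
  ∀ x l m : ℂ, (x + b * l) * F (x + l) m - (x + m + a * l) * F x m = -m * F x (l + m)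

/-- The coefficient of `∂ᵖ λ^q` in `(∂ + b λ) (∂ + λ) ^ (p + q - 1)`. -/
def virBinom (b : ℂ) (p q : ℕ) : ℂ := (p + q - 1).choose q + b * (p + q - 1).choose (q - 1)

theorem virBinom_zero_left (b : ℂ) {q : ℕ} (hq : 1 ≤ q) : virBinom b 0 q = b := by
  obtain ⟨q, rfl⟩ := Nat.exists_eq_add_of_le' hq
  simp [virBinom]

theorem virBinom_one_right (b : ℂ) (p : ℕ) : virBinom b p 1 = p + b := by
  simp [virBinom]

theorem TriPoly.co_virBinom_l (b : ℂ) (f : BiPoly) (p r : ℕ) {q : ℕ} (hq : 1 ≤ q) :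
    ((d + const b * l) * sub (d + l) m f).co p q r =
      virBinom b p q * (f.coeff r).coeff (p + q - 1) := by
  obtain ⟨q, rfl⟩ := Nat.exists_eq_add_of_le' hq
  rw [add_mul, mul_assoc, co_add, co_const_mul, co_d_mul, co_l_mul, co_sub_d_add_l_m,
    co_sub_d_add_l_m]
  cases p with
  | zero => simp [virBinom]
  | succ p =>
    simp only [virBinom, Nat.add_sub_cancel, Nat.succ_ne_zero, if_false]
    rw [show p + 1 + (q + 1) - 1 = p + (q + 1) by omega, show p + 1 + q = p + (q + 1) by omega]
    ring

theorem TriPoly.co_virBinom_m (b : ℂ) (f : BiPoly) (p q : ℕ) {r : ℕ} (hr : 1 ≤ r) :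
    ((d + const b * m) * sub (d + m) l f).co p q r =
      virBinom b p r * (f.coeff q).coeff (p + r - 1) := by
  obtain ⟨r, rfl⟩ := Nat.exists_eq_add_of_le' hr
  rw [add_mul, mul_assoc, co_add, co_const_mul, co_d_mul, co_m_mul, co_sub_d_add_m_l,
    co_sub_d_add_m_l]
  cases p with
  | zero => simp [virBinom]
  | succ p =>
    simp only [virBinom, Nat.add_sub_cancel, Nat.succ_ne_zero, if_false]
    rw [show p + 1 + (r + 1) - 1 = p + (r + 1) by omega, show p + 1 + r = p + (r + 1) by omega]
    ring

/-- Products are expanded except for `(∂ + bλ) f(∂ + λ, μ)`, whose coefficients are given as a whole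
by `virBinom`; the `co_` lemmas then apply term by term. -/
theorem IsCurCocycle.triPoly {a b : ℂ} {f : BiPoly} (h : IsCurCocycle a b (biEval f)) :
    (d + const b * l) * sub (d + l) m f - (d * sub d m f + m * sub d m f +
      const a * (l * sub d m f)) = -(m * sub d (l + m) f) := by
  refine ext_ev fun x y z => ?_
  simp only [map_sub (ev x y z), map_add (ev x y z), map_mul (ev x y z), map_neg (ev x y z),
    ev_sub, ev_d, ev_l, ev_m, ev_const]
  linear_combination h x y z

theorem IsVirCocycle.triPoly {a b : ℂ} {f : BiPoly} (h : IsVirCocycle a b (biEval f)) :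
    (d * sub d l f + l * sub d l f + const a * (m * sub d l f)) +
      (d + const b * l) * sub (d + l) m f - (d * sub d m f + m * sub d m f +
      const a * (l * sub d m f)) - (d + const b * m) * sub (d + m) l f =
      l * sub d (l + m) f - m * sub d (l + m) f := by
  refine ext_ev fun x y z => ?_
  simp only [map_sub (ev x y z), map_add (ev x y z), map_mul (ev x y z), ev_sub,
    ev_d, ev_l, ev_m, ev_const]
  linear_combination h x y z

section Coefficients

variable {a b : ℂ} {f : BiPoly}

/-- The derivative of the cocycle identity at `λ = 0` is Euler's equation: `∂ · f_∂ + μ · f_μ = (a -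
b) f`. Hence `f` is homogeneous of degree `a - b`. -/
theorem IsCurCocycle.coeff_one (h : IsCurCocycle a b (biEval f)) (p r : ℕ) :
    (p + r + b - a) * (f.coeff r).coeff p = 0 := by
  have := congrArg (fun P : TriPoly => P.co p 1 r) h.triPoly
  simp only [co_sub, co_add, co_neg, co_virBinom_l b f p r le_rfl, co_const_mul, co_d_mul,
    co_l_mul, co_m_mul, co_sub_d_m, co_sub_d_l_add_m, virBinom_one_right] at this
  cases r <;> simp [-mul_eq_zero] at this ⊢
  · linear_combination this
  · rename_i r
    rw [show 1 + r = r + 1 by omega] at this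
    linear_combination this

/-- The term `(∂ + μ + aλ) f(∂, μ)` has degree at most one in `λ`, so `a` drops out once `q ≥ 2`. -/
theorem IsCurCocycle.coeff_two_le (h : IsCurCocycle a b (biEval f)) (p : ℕ) {q r : ℕ}
    (hq : 2 ≤ q) (hr : 1 ≤ r) :
    virBinom b p q * (f.coeff r).coeff (p + q - 1) +
      (q + r - 1).choose q * (f.coeff (q + r - 1)).coeff p = 0 := by
  have := congrArg (fun P : TriPoly => P.co p q r) h.triPoly
  simp only [co_sub, co_add, co_neg, co_virBinom_l b f p r (by omega : 1 ≤ q), co_const_mul,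
    co_d_mul, co_l_mul, co_m_mul, co_sub_d_m, co_sub_d_l_add_m] at this
  rw [show q + (r - 1) = q + r - 1 by omega] at this
  simp only [show q ≠ 0 by omega, show q - 1 ≠ 0 by omega, show r ≠ 0 by omega, if_false] at this
  simp at this
  linear_combination this

theorem IsCurCocycle.coeff_zero (h : IsCurCocycle a b (biEval f)) (p : ℕ) {q : ℕ}
    (hq : 2 ≤ q) : virBinom b p q * (f.coeff 0).coeff (p + q - 1) = 0 := by
  have := congrArg (fun P : TriPoly => P.co p q 0) h.triPoly
  simp only [co_sub, co_add, co_neg, co_virBinom_l b f p 0 (by omega : 1 ≤ q), co_const_mul,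
    co_d_mul, co_l_mul, co_m_mul, co_sub_d_m, co_sub_d_l_add_m] at this
  simp only [show q ≠ 0 by omega, show q - 1 ≠ 0 by omega, if_false] at this
  simpa using this

theorem IsVirCocycle.coeff_one_zero (h : IsVirCocycle a b (biEval f)) (p : ℕ) :
    (p + b - a) * (f.coeff 0).coeff p = 0 := by
  have := congrArg (fun P : TriPoly => P.co p 1 0) h.triPoly
  simp only [co_sub, co_add, co_virBinom_l b f p 0 le_rfl, co_const_mul, co_d_mul, co_l_mul,
    co_m_mul, co_sub_d_m, co_sub_d_l, co_sub_d_l_add_m, virBinom_one_right,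
    add_mul d (const b * m), mul_assoc (const b), co_sub_d_add_m_l] at this
  simp at this
  linear_combination this

theorem IsVirCocycle.coeff_two_le_zero (h : IsVirCocycle a b (biEval f)) (p : ℕ) {q : ℕ}
    (hq : 2 ≤ q) : virBinom b p q * (f.coeff 0).coeff (p + q - 1) = 0 := by
  have := congrArg (fun P : TriPoly => P.co p q 0) h.triPoly
  simp only [co_sub, co_add, co_virBinom_l b f p 0 (by omega : 1 ≤ q), co_const_mul, co_d_mul,
    co_l_mul, co_m_mul, co_sub_d_m, co_sub_d_l, co_sub_d_l_add_m,
    add_mul d (const b * m), mul_assoc (const b), co_sub_d_add_m_l] at this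
  simp only [show q ≠ 0 by omega, show q - 1 ≠ 0 by omega, if_false] at this
  simp at this
  linear_combination this

/-- Outside total degree `a - b + 1`, every coefficient of `λ^q` with `q ≥ 2` is determined by the
coefficient of `λ`, which is the one that coboundaries can adjust. -/
theorem IsVirCocycle.coeff_two_le_one (h : IsVirCocycle a b (biEval f)) (p : ℕ) {q : ℕ}
    (hq : 2 ≤ q) : (p + q - 1 + b - a) * (f.coeff q).coeff p =
      virBinom b p q * (f.coeff 1).coeff (p + q - 1) := by
  have := congrArg (fun P : TriPoly => P.co p q 1) h.triPoly
  simp only [co_sub, co_add, co_virBinom_l b f p 1 (by omega : 1 ≤ q),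
    co_virBinom_m b f p q le_rfl, co_const_mul, co_d_mul, virBinom_one_right,
    co_l_mul, co_m_mul, co_sub_d_m, co_sub_d_l, co_sub_d_l_add_m] at this
  simp only [show q ≠ 0 by omega, show q - 1 ≠ 0 by omega, if_false] at this
  obtain ⟨q, rfl⟩ := Nat.exists_eq_add_of_le' hq
  simp [Nat.choose_succ_self_right] at this ⊢
  linear_combination -this

theorem IsVirCocycle.coeff_two_le_two_le (h : IsVirCocycle a b (biEval f)) (p : ℕ) {q r : ℕ}
    (hq : 2 ≤ q) (hr : 2 ≤ r) : virBinom b p q * (f.coeff r).coeff (p + q - 1) -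
      virBinom b p r * (f.coeff q).coeff (p + r - 1) =
      ((q + r - 1).choose (q - 1) - (q + r - 1).choose q) * (f.coeff (q + r - 1)).coeff p := by
  have := congrArg (fun P : TriPoly => P.co p q r) h.triPoly
  simp only [co_sub, co_add, co_virBinom_l b f p r (by omega : 1 ≤ q),
    co_virBinom_m b f p q (by omega : 1 ≤ r), co_const_mul, co_d_mul,
    co_l_mul, co_m_mul, co_sub_d_m, co_sub_d_l, co_sub_d_l_add_m] at this
  simp only [show q ≠ 0 by omega, show q - 1 ≠ 0 by omega, show r ≠ 0 by omega,
    show r - 1 ≠ 0 by omega, if_false, show q - 1 + r = q + r - 1 by omega,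
    show q + (r - 1) = q + r - 1 by omega] at this
  simp at this
  linear_combination this

end Coefficients

section Choose

theorem cast_choose_three (n : ℕ) : (n.choose 3 : ℂ) = n * (n - 1) * (n - 2) / 6 := by
  induction n with
  | zero => simp
  | succ n ih => rw [Nat.choose_succ_succ' n 2]; push_cast; rw [ih, Nat.cast_choose_two]; ring

theorem cast_choose_four (n : ℕ) : (n.choose 4 : ℂ) = n * (n - 1) * (n - 2) * (n - 3) / 24 := by
  induction n with
  | zero => simp
  | succ n ih => rw [Nat.choose_succ_succ' n 3]; push_cast; rw [ih, cast_choose_three]; ring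

theorem cast_choose_five (n : ℕ) :
    (n.choose 5 : ℂ) = n * (n - 1) * (n - 2) * (n - 3) * (n - 4) / 120 := by
  induction n with
  | zero => simp
  | succ n ih => rw [Nat.choose_succ_succ' n 4]; push_cast; rw [ih, cast_choose_four]; ring

theorem cast_choose_six (n : ℕ) :
    (n.choose 6 : ℂ) = n * (n - 1) * (n - 2) * (n - 3) * (n - 4) * (n - 5) / 720 := by
  induction n with
  | zero => simp
  | succ n ih => rw [Nat.choose_succ_succ' n 5]; push_cast; rw [ih, cast_choose_five]; ring

theorem cast_choose_seven (n : ℕ) :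
    (n.choose 7 : ℂ) = n * (n - 1) * (n - 2) * (n - 3) * (n - 4) * (n - 5) * (n - 6) / 5040 := by
  induction n with
  | zero => simp
  | succ n ih => rw [Nat.choose_succ_succ' n 6]; push_cast; rw [ih, cast_choose_six]; ring

end Choose

/-! ### Homogeneous polynomials and the cocycles for `N` -/

/-- The homogeneous polynomial `∑ Fᵢ ∂ⁿ⁻ⁱ λⁱ` of degree `n`. -/
noncomputable def homPoly (n : ℕ) (F : ℕ → ℂ) : BiPoly :=
  ∑ i ∈ Finset.range (n + 1), monomial i (monomial (n - i) (F i))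

theorem coeff_homPoly (n : ℕ) (F : ℕ → ℂ) (i j : ℕ) :
    ((homPoly n F).coeff i).coeff j = if i + j = n then F i else 0 := by
  simp only [homPoly, finsetSum_coeff, coeff_monomial]
  by_cases h : i ∈ Finset.range (n + 1)
  · rw [Finset.sum_eq_single_of_mem i h (by intro t _ ht; simp [ht])]
    rw [Finset.mem_range] at h
    simp only [if_true, coeff_monomial]
    grind
  · rw [Finset.sum_eq_zero (by intro t ht; simp [ne_of_mem_of_not_mem ht h])]
    rw [Finset.mem_range] at h
    rw [if_neg (by omega)]

theorem biEval_homPoly (n : ℕ) (F : ℕ → ℂ) (x y : ℂ) :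
    biEval (homPoly n F) x y = ∑ i ∈ Finset.range (n + 1), F i * x ^ (n - i) * y ^ i := by
  simp [biEval, homPoly, eval_finsetSum]

theorem BiPoly.ext_coeff {f g : BiPoly} (h : ∀ i j, (f.coeff i).coeff j = (g.coeff i).coeff j) :
    f = g := Polynomial.ext fun i => Polynomial.ext fun j => h i j

theorem eq_homPoly {n : ℕ} {f : BiPoly}
    (h : ∀ i j, i + j ≠ n → (f.coeff i).coeff j = 0) :
    f = homPoly n fun i => (f.coeff i).coeff (n - i) := by
  refine BiPoly.ext_coeff fun i j => ?_
  rw [coeff_homPoly]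
  split_ifs with hij
  · rw [← hij, Nat.add_sub_cancel_left]
  · exact h i j hij

/-- By homogeneity `k = ∑ Fᵢ ∂ⁿ⁻ⁱ λⁱ` with `n = a - b`. For `n ≥ 1`, `b ≠ 0` kills `F₀`, and the
relations linear in `μ` give all `Fⱼ` from `F₁`. The relations at `μ²` are vacuous for `n ≤ 2`,
force `b = -2` for `n = 3`, and contradict each other for `n ≥ 4` unless `F₁ = 0`. -/
theorem cur_classification {a b : ℂ} (hb : b ≠ 0) {k : BiPoly}
    (h : IsCurCocycle a b (biEval k)) :
    k = 0 ∨ (a = b ∧ ∃ c, ∀ x y, biEval k x y = c) ∨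
      (a - b = 1 ∧ ∃ c, ∀ x y, biEval k x y = c * y) ∨
      (a - b = 2 ∧ ∃ c, ∀ x y, biEval k x y = c * (y * (x - b * y))) ∨
      (a = 1 ∧ b = -2 ∧
        ∃ c, ∀ x y, biEval k x y = c * (y * (x ^ 2 + 3 * x * y + 2 * y ^ 2))) := by
  by_cases hn : ∃ n : ℕ, a - b = n
  swap
  · refine Or.inl (BiPoly.ext_coeff fun i j => ?_)
    refine (mul_eq_zero.mp (h.coeff_one j i)).resolve_left fun h0 => hn ⟨j + i, ?_⟩
    push_cast
    linear_combination -h0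
  obtain ⟨n, hn⟩ := hn
  have hhom : ∀ i j, i + j ≠ n → (k.coeff i).coeff j = 0 := by
    intro i j hij
    refine (mul_eq_zero.mp (h.coeff_one j i)).resolve_left fun h0 => hij ?_
    have : ((i + j : ℕ) : ℂ) = n := by
      push_cast
      linear_combination h0 + hn
    exact_mod_cast this
  have hk := eq_homPoly hhom
  set F : ℕ → ℂ := fun i => (k.coeff i).coeff (n - i) with hF
  have hk' := biEval_homPoly n F
  rw [← hk] at hk'
  have h0 : 1 ≤ n → F 0 = 0 := by
    intro hn1
    -- At `∂⁰ λⁿ⁺¹ μ⁰` the factor of `F₀` is exactly `b`.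
    have := h.coeff_zero 0 (q := n + 1) (by omega)
    rw [virBinom_zero_left b (by omega)] at this
    simpa [hb, hF] using this
  have h1 : ∀ j, 2 ≤ j → j ≤ n → F j = -virBinom b (n - j) j * F 1 := by
    intro j hj hjn
    have := h.coeff_two_le (n - j) hj le_rfl
    rw [show n - j + j - 1 = n - 1 by omega, show j + 1 - 1 = j by omega, Nat.choose_self] at this
    simp only [hF]
    push_cast at this
    linear_combination this
  have h2 : ∀ j, 2 ≤ j → j + 1 ≤ n →
      virBinom b (n - j - 1) j * F 2 + (j + 1) * F (j + 1) = 0 := by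
    intro j hj hjn
    have := h.coeff_two_le (n - j - 1) hj one_le_two
    rw [show n - j - 1 + j - 1 = n - 2 by omega, show j + 2 - 1 = j + 1 by omega,
      Nat.choose_succ_self_right, show n - j - 1 = n - (j + 1) by omega] at this
    simp only [hF]
    push_cast at this
    rw [show n - j - 1 = n - (j + 1) by omega]
    linear_combination this
  have hzero : 1 ≤ n → F 1 = 0 → k = 0 := by
    intro hn1 hF1
    rw [hk]
    refine BiPoly.ext_coeff fun i j => ?_
    rw [coeff_homPoly]
    split_ifs with hij
    · rcases Nat.lt_or_ge i 2 with hi | hi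
      · interval_cases i
        · simpa using h0 hn1
        · simpa using hF1
      · rw [h1 i hi (by omega), hF1]
        simp
    · simp
  match n, h0, h1, h2, hzero with
  | 0, _, _, _, _ =>
    refine Or.inr (Or.inl ⟨by simpa [sub_eq_zero] using hn, F 0, fun x y => ?_⟩)
    simp [hk']
  | 1, h0, _, _, _ =>
    refine Or.inr (Or.inr (Or.inl ⟨by simpa using hn, F 1, fun x y => ?_⟩))
    simp [hk', Finset.sum_range_succ, h0 le_rfl]
  | 2, h0, h1, _, _ =>
    refine Or.inr (Or.inr (Or.inr (Or.inl ⟨by simpa using hn, F 1, fun x y => ?_⟩)))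
    have := h1 2 le_rfl le_rfl
    rw [virBinom_zero_left b (by omega)] at this
    simp [hk', Finset.sum_range_succ, h0 one_le_two, this]
    ring
  | 3, h0, h1, h2, hzero =>
    have e2 := h1 2 le_rfl (by omega)
    have e3 := h1 3 (by omega) le_rfl
    have e4 := h2 2 le_rfl le_rfl
    norm_num [virBinom, Nat.choose] at e2 e3 e4
    have h0' := h0 (by omega)
    have : F 1 * (b + 2) = 0 := by
      have : b * (F 1 * (b + 2)) = 0 := by
        rw [e3, e2] at e4
        linear_combination -e4 / 2
      exact (mul_eq_zero.mp this).resolve_left hb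
    rcases mul_eq_zero.mp this with h1' | hb2
    · exact Or.inl (hzero (by omega) h1')
    · have hb2 : b = -2 := by linear_combination hb2
      refine Or.inr (Or.inr (Or.inr (Or.inr ⟨?_, hb2, F 1, fun x y => ?_⟩)))
      · push_cast at hn
        linear_combination hn + hb2
      · simp [hk', Finset.sum_range_succ, h0', e2, e3, hb2]
        ring
  | m + 4, h0, h1, h2, hzero =>
    have e2 := h1 2 le_rfl (by omega)
    have e3 := h1 3 (by omega) (by omega)
    have e4 := h1 4 (by omega) (by omega)
    have e5 := h2 2 le_rfl (by omega)
    have e6 := h2 3 (by omega) (by omega)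
    simp only [virBinom, show m + 4 - 2 + 2 - 1 = m + 3 by omega,
      show m + 4 - 3 + 3 - 1 = m + 3 by omega, show m + 4 - 4 + 4 - 1 = m + 3 by omega,
      show m + 4 - 2 - 1 + 2 - 1 = m + 2 by omega, show m + 4 - 3 - 1 + 3 - 1 = m + 2 by omega,
      Nat.reduceSub, Nat.choose_one_right, Nat.cast_choose_two, cast_choose_three,
      cast_choose_four] at e2 e3 e4 e5 e6
    push_cast at e2 e3 e4 e5 e6
    norm_num at e6
    have hm : ∀ t : ℕ, 1 ≤ t → (m : ℂ) + t ≠ 0 := by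
      intro t ht
      exact_mod_cast (by omega : m + t ≠ 0)
    have m1 := hm 1 (by omega)
    have m2 := hm 2 (by omega)
    have m3 := hm 3 (by omega)
    have m6 := hm 6 (by omega)
    push_cast at m1 m2 m3 m6
    -- With `n = m + 4`, the relations at `λ²μ²` and `λ³μ²` become two quadratics `E1`, `E2` in `b`
    -- after division by `F₁`. Their difference factors as `(n + 2b)(b - 1)`: the first factor turns
    -- `E1` into `2b = 0`, the second turns it into a positive integer being zero.
    have hF1 : F 1 = 0 := by
      by_contra hne
      rw [e2, e3] at e5
      rw [e2, e4] at e6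
      have E1 : (m + 4 + 2 * b) * (m + 1 + 2 * b) + 2 * b = 0 := by
        have : F 1 * ((m + 3) * (m + 2)) * ((m + 4 + 2 * b) * (m + 1 + 2 * b) + 2 * b) = 0 := by
          linear_combination -4 * e5
        simpa [hne, m3, m2] using this
      have E2 : (m + 4 + 2 * b) * (m + 3 * b) + 2 * b = 0 := by
        have : F 1 * ((m + 3) * (m + 2) * (m + 1)) *
            ((m + 4 + 2 * b) * (m + 3 * b) + 2 * b) = 0 := by
          linear_combination -12 * e6
        simpa [hne, m3, m2, m1] using this
      have E3 : (m + 4 + 2 * b) * (b - 1) = 0 := by linear_combination E2 - E1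
      rcases mul_eq_zero.mp E3 with h' | h'
      · exact hb (by linear_combination (E1 - (m + 1 + 2 * b) * h') / 2)
      · have : ((m : ℂ) + 6) * (m + 3) + 2 = 0 := by
          linear_combination E1 - (2 * m + 4 * b + 2 * m + 10 + 6) * h'
        have : (((m + 6) * (m + 3) + 2 : ℕ) : ℂ) = 0 := by push_cast; exact this
        exact absurd (Nat.cast_eq_zero.mp this) (by omega)
    exact Or.inl (hzero (by omega) hF1)

/-! ### Virasoro cocycles: coboundaries and normal form -/

namespace IsVirCocycle

variable {a b : ℂ} {F G : ℂ → ℂ → ℂ}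

theorem add (hF : IsVirCocycle a b F) (hG : IsVirCocycle a b G) :
    IsVirCocycle a b fun x y => F x y + G x y := fun x l m => by
  linear_combination hF x l m + hG x l m

theorem const_mul (hF : IsVirCocycle a b F) (c : ℂ) :
    IsVirCocycle a b fun x y => c * F x y := fun x l m => by
  linear_combination c * hF x l m

theorem cobdry (a b : ℂ) (φ : ℂ[X]) : IsVirCocycle a b (virCobdry a b φ) := fun x l m => by
  simp only [virCobdry, add_right_comm x m l, add_assoc x l m]
  ring

end IsVirCocycle

/-- The coboundary of `φ(∂)`, as a polynomial. -/
noncomputable def virCobdryPoly (a b : ℂ) (φ : ℂ[X]) : BiPoly :=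
  (C X + C (C b) * X) * φ.eval₂ (C.comp C) (X + C X) - (C X + C (C a) * X) * C φ

theorem biEval_virCobdryPoly (a b : ℂ) (φ : ℂ[X]) (x y : ℂ) :
    biEval (virCobdryPoly a b φ) x y = virCobdry a b φ x y := by
  simp [biEval, virCobdryPoly, virCobdry, sv_eval_eval₂, eval_comp, add_comm]

theorem coeff_translate (φ : ℂ[X]) (i j : ℕ) :
    ((φ.eval₂ (C.comp C) (X + C X) : BiPoly).coeff i).coeff j =
      (i + j).choose i * φ.coeff (i + j) := by
  induction φ using Polynomial.induction_on' with
  | add p q hp hq => rw [eval₂_add, coeff_add, coeff_add, hp, hq, coeff_add]; ring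
  | monomial n c =>
    rw [eval₂_monomial, RingHom.comp_apply, coeff_C_mul, coeff_C_mul, coeff_X_add_C_pow,
      ← C_eq_natCast, coeff_mul_C, coeff_X_pow, coeff_monomial]
    rcases Nat.lt_or_ge n i with h | h
    · rw [Nat.choose_eq_zero_of_lt h, if_neg (by omega : ¬n = i + j)]
      simp
    · by_cases hj : j = n - i
      · rw [if_pos hj, if_pos (by omega : n = i + j), show i + j = n by omega]
        ring
      · rw [if_neg hj, if_neg (by omega : ¬n = i + j)]
        simp

/-- At `λ = 0` the two terms of the coboundary cancel. -/
theorem coeff_virCobdryPoly_zero (a b : ℂ) (φ : ℂ[X]) : (virCobdryPoly a b φ).coeff 0 = 0 := by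
  ext j
  simp only [virCobdryPoly, add_mul, mul_assoc, coeff_sub, coeff_add, coeff_C_mul,
    coeff_X_mul_zero, coeff_C_zero]
  cases j <;> simp [coeff_translate]

theorem coeff_virCobdryPoly_one (a b : ℂ) (φ : ℂ[X]) (j : ℕ) :
    ((virCobdryPoly a b φ).coeff 1).coeff j = (j + b - a) * φ.coeff j := by
  simp only [virCobdryPoly, add_mul, mul_assoc, coeff_sub, coeff_add, coeff_C_mul,
    coeff_X_mul _ 0, coeff_C_zero]
  cases j <;> simp [coeff_translate, add_comm 1] <;> ring

theorem coeff_virCobdryPoly_two_le (a b : ℂ) (φ : ℂ[X]) {i : ℕ} (hi : 2 ≤ i) (j : ℕ) :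
    ((virCobdryPoly a b φ).coeff i).coeff j = virBinom b j i * φ.coeff (j + i - 1) := by
  obtain ⟨i, rfl⟩ := Nat.exists_eq_add_of_le' hi
  simp only [virCobdryPoly, add_mul, mul_assoc, coeff_sub, coeff_add, coeff_C_mul,
    coeff_X_mul _ (i + 1), coeff_C]
  cases j with
  | zero => simp [coeff_translate, virBinom]
  | succ j =>
    simp only [coeff_X_mul, coeff_translate, virBinom]
    rw [show i + 1 + (j + 1) = j + (i + 2) by omega, show i + 2 + j = j + (i + 2) by omega,
      show j + 1 + (i + 2) - 1 = j + (i + 2) by omega]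
    simp
    ring

/-- Homogeneous cocycles of degree `n + 1` that are divisible by `λ²`. -/
structure IsVirNormal (b : ℂ) (n : ℕ) (f : BiPoly) : Prop where
  cocycle : IsVirCocycle (b + n) b (biEval f)
  hom : ∀ i j, i + j ≠ n + 1 → (f.coeff i).coeff j = 0
  coeff_zero : f.coeff 0 = 0
  coeff_one : f.coeff 1 = 0

theorem biEval_add (f g : BiPoly) (x y : ℂ) :
    biEval (f + g) x y = biEval f x y + biEval g x y := by
  simp [biEval]

theorem biEval_biC_mul (c : ℂ) (f : BiPoly) (x y : ℂ) :
    biEval (biC c * f) x y = c * biEval f x y := by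
  simp [biEval, biC]

/-- The coboundary of `φ` has `λ`-coefficients `(j + b - a) φⱼ`, so `φ` can be chosen to cancel the
coefficient of `λ` in `f` except at `j = a - b`. By `coeff_two_le_one` the higher coefficients of
the remainder then vanish outside total degree `a - b + 1`, and `b ≠ 0` disposes of the surplus
terms in `λ⁰` and `λ¹`. -/
theorem vir_normal_form {a b : ℂ} (hb : b ≠ 0) {f : BiPoly} (h : IsVirCocycle a b (biEval f)) :
    (∃ φ : ℂ[X], ∀ x y, biEval f x y = virCobdry a b φ x y) ∨
      (a = b ∧ ∃ (φ : ℂ[X]) (c₀ c₁ : ℂ), ∀ x y,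
        biEval f x y = virCobdry a b φ x y + (c₀ + c₁ * y)) ∨
      ∃ n : ℕ, 1 ≤ n ∧ a = b + n ∧ ∃ (φ : ℂ[X]) (f' : BiPoly),
        (∀ x y, biEval f x y = virCobdry a b φ x y + biEval f' x y) ∧ IsVirNormal b n f' := by
  classical
  -- At the resonant index `j = a - b` the quotient is `0` by division by zero; any value would do
  -- there, since the coboundary does not see `φⱼ` in its coefficient of `λ`.
  let φ : ℂ[X] := ∑ j ∈ (f.coeff 1).support, monomial j ((f.coeff 1).coeff j / (j + b - a))
  have hφ : ∀ j, φ.coeff j = (f.coeff 1).coeff j / (j + b - a) := by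
    intro j
    simp only [φ, finsetSum_coeff, coeff_monomial, Finset.sum_ite_eq']
    split_ifs with hj
    · rfl
    · rw [notMem_support_iff.mp hj, zero_div]
  let f' : BiPoly := f - virCobdryPoly a b φ
  have hf : ∀ x y, biEval f x y = virCobdry a b φ x y + biEval f' x y := by
    intro x y
    rw [← biEval_virCobdryPoly, ← biEval_add, add_sub_cancel]
  have hf' : IsVirCocycle a b (biEval f') := by
    have := h.add ((IsVirCocycle.cobdry a b φ).const_mul (-1))
    convert this using 3 with x y
    rw [hf]
    ring
  have hone : ∀ j : ℕ, j + b - a ≠ 0 → (f'.coeff 1).coeff j = 0 := by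
    intro j hj
    rw [show f' = f - virCobdryPoly a b φ from rfl, coeff_sub, coeff_sub,
      coeff_virCobdryPoly_one, hφ, mul_div_cancel₀ _ hj, sub_self]
  clear_value f'
  have hzero : ∀ j : ℕ, 1 ≤ j → (f'.coeff 0).coeff j = 0 := by
    intro j hj
    have := hf'.coeff_two_le_zero 0 (q := j + 1) (by omega)
    rw [virBinom_zero_left b (by omega)] at this
    simpa [hb] using this
  have htwo : ∀ i j : ℕ, 2 ≤ i → (j + i - 1 + b - a : ℂ) ≠ 0 → (f'.coeff i).coeff j = 0 := by
    intro i j hi hij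
    have h' := hf'.coeff_two_le_one j hi
    rw [hone (j + i - 1), mul_zero] at h'
    · exact (mul_eq_zero.mp h').resolve_left hij
    · rw [Nat.cast_sub (by omega)]
      push_cast
      exact hij
  by_cases hab : a = b
  · refine Or.inr (Or.inl ⟨hab, φ, (f'.coeff 0).coeff 0, (f'.coeff 1).coeff 0, fun x y => ?_⟩)
    have : f' = biC ((f'.coeff 0).coeff 0) + biC ((f'.coeff 1).coeff 0) * biL := by
      refine BiPoly.ext_coeff fun i j => ?_
      simp only [biC, biL, coeff_add, coeff_C_mul]
      match i, j with
      | 0, 0 => simp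
      | 0, j + 1 => simp [hzero]
      | 1, 0 => simp
      | 1, j + 1 =>
        rw [hone (j + 1) (by rw [hab, add_sub_cancel_right]; exact_mod_cast j.succ_ne_zero)]
        simp [coeff_one]
      | i + 2, j =>
        rw [htwo (i + 2) j (by omega)]
        · simp [coeff_X]
        · rw [hab, add_sub_cancel_right]
          push_cast
          rw [show (j + (i + 2) - 1 : ℂ) = ((j + i + 1 : ℕ) : ℂ) by push_cast; ring]
          exact_mod_cast (j + i).succ_ne_zero
    rw [hf]
    conv_lhs => rw [this]
    simp [biEval, biC, biL]
  have hzero' : f'.coeff 0 = 0 := by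
    ext j
    cases j with
    | zero =>
      have := hf'.coeff_one_zero 0
      simpa [sub_eq_zero, Ne.symm hab] using this
    | succ j => simp [hzero]
  by_cases hn : ∃ n : ℕ, 1 ≤ n ∧ a = b + n
  · obtain ⟨n, hn1, hn⟩ := hn
    have hone' : f'.coeff 1 = 0 := by
      ext j
      by_cases hj : j = n
      -- The resonant coefficient of `∂ⁿλ`: at `∂⁰ λⁿ⁺¹ μ` the left factor `n + b - a` is zero and
      -- the right factor is `b ≠ 0`.
      · have := hf'.coeff_two_le_one 0 (q := n + 1) (by omega)
        rw [virBinom_zero_left b (by omega), zero_add, Nat.add_sub_cancel, hn] at this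
        push_cast at this
        have : b * (f'.coeff 1).coeff n = 0 := by linear_combination -this
        rw [hj]
        simpa [hb] using this
      · rw [hone, Polynomial.coeff_zero]
        intro h0
        exact hj (Nat.cast_injective (R := ℂ) (by linear_combination h0 + hn))
    refine Or.inr (Or.inr ⟨n, hn1, hn, φ, f', hf, hn ▸ hf', fun i j hij => ?_, hzero', hone'⟩)
    match i with
    | 0 => simp [hzero']
    | 1 => simp [hone']
    | i + 2 =>
      refine htwo _ _ (by omega) fun h0 => hij ?_
      have : ((i + 2 + j : ℕ) : ℂ) = (n + 1 : ℕ) := by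
        push_cast at h0 ⊢
        linear_combination h0 + hn
      exact_mod_cast this
  · have hn' : ∀ j : ℕ, j + b - a ≠ 0 := by
      intro j hj
      rcases Nat.eq_zero_or_pos j with rfl | hj0
      · exact hab (by push_cast at hj; linear_combination -hj)
      · exact hn ⟨j, hj0, by linear_combination -hj⟩
    have : f' = 0 := by
      refine BiPoly.ext_coeff fun i j => ?_
      match i with
      | 0 => simp [hzero']
      | 1 => simp [hone j (hn' j)]
      | i + 2 =>
        rw [htwo _ _ (by omega)]
        · simp
        · convert hn' (j + i + 1) using 1
          push_cast
          ring
    refine Or.inl ⟨φ, fun x y => ?_⟩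
    rw [hf, this]
    simp [biEval]

/-! ### Normal cocycles: a plane cut down by a determinant -/

/-- The relation at `λ^q μ²` with `q ≥ 3` is a recursion for the coefficient of `λ^(q+1)`. Its
leading factor `C(q+1, 2) - (q+1) = (q+1)(q-2)/2` is nonzero, so normal cocycles form a space of
dimension at most two. -/
theorem IsVirNormal.eq_zero {b : ℂ} {n : ℕ} {f : BiPoly} (h : IsVirNormal b n f)
    (h2 : (f.coeff 2).coeff (n - 1) = 0) (h3 : (f.coeff 3).coeff (n - 2) = 0) : f = 0 := by
  have key : ∀ i, (f.coeff i).coeff (n + 1 - i) = 0 := by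
    intro i
    induction i using Nat.strong_induction_on with
    | _ i ih =>
      match i with
      | 0 => simp [h.coeff_zero]
      | 1 => simp [h.coeff_one]
      | 2 => exact h2
      | 3 => exact h3
      | i + 4 =>
        rcases Nat.lt_or_ge (n + 1) (i + 4) with hi | hi
        · exact h.hom _ _ (by omega)
        have := h.cocycle.coeff_two_le_two_le (n + 1 - (i + 4)) (q := i + 3) (r := 2)
          (by omega) le_rfl
        rw [show n + 1 - (i + 4) + (i + 3) - 1 = n + 1 - 2 by omega,
          show n + 1 - (i + 4) + 2 - 1 = n + 1 - (i + 3) by omega,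
          show i + 3 + 2 - 1 = i + 4 by omega, ih 2 (by omega), ih (i + 3) (by omega),
          show i + 3 - 1 = i + 2 by omega, Nat.choose_symm_of_eq_add (b := 2) (by omega),
          Nat.choose_succ_self_right, Nat.cast_choose_two] at this
        rw [show n + 1 - (i + 4) = n - (i + 3) by omega] at this ⊢
        push_cast at this
        have : ((i : ℂ) + 4) * (i + 1) * (f.coeff (i + 4)).coeff (n - (i + 3)) = 0 := by
          linear_combination -2 * this
        refine (mul_eq_zero.mp this).resolve_left ?_
        exact_mod_cast (by positivity : (i + 4) * (i + 1) ≠ 0)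
  refine BiPoly.ext_coeff fun i j => ?_
  by_cases hij : i + j = n + 1
  · rw [show j = n + 1 - i by omega, key]
    simp
  · simp [h.hom i j hij]

theorem IsVirNormal.sub_smul_sub_smul {b : ℂ} {n : ℕ} {f g e : BiPoly} (hf : IsVirNormal b n f)
    (hg : IsVirNormal b n g) (he : IsVirNormal b n e) (s t : ℂ) :
    IsVirNormal b n (f + biC (-s) * g + biC (-t) * e) where
  cocycle := by
    have := (hf.cocycle.add (hg.cocycle.const_mul (-s))).add (he.cocycle.const_mul (-t))
    simpa only [← biEval_add, ← biEval_biC_mul] using this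
  hom i j hij := by
    simp only [biC, coeff_add, coeff_C_mul, hf.hom i j hij, hg.hom i j hij, he.hom i j hij]
    simp
  coeff_zero := by simp [hf.coeff_zero, hg.coeff_zero, he.coeff_zero]
  coeff_one := by
    simp only [biC, coeff_add, coeff_C_mul, hf.coeff_one, hg.coeff_one, he.coeff_one]
    simp

/-- The coboundary of `∂ⁿ` has `λ`-coefficient `n + b - a = 0`, so it survives in the normal form
and is the ambiguity still to be divided out. -/
theorem isVirNormal_virCobdryPoly (b : ℂ) {n : ℕ} (hn : 1 ≤ n) :
    IsVirNormal b n (virCobdryPoly (b + n) b (X ^ n)) where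
  cocycle := by
    have : biEval (virCobdryPoly (b + n) b (X ^ n)) = virCobdry (b + n) b (X ^ n) :=
      funext₂ fun x y => biEval_virCobdryPoly _ _ _ x y
    rw [this]
    exact .cobdry _ _ _
  hom i j hij := by
    match i with
    | 0 => simp [coeff_virCobdryPoly_zero]
    | 1 =>
      rw [coeff_virCobdryPoly_one, coeff_X_pow, if_neg (by omega), mul_zero]
    | i + 2 =>
      rw [coeff_virCobdryPoly_two_le _ _ _ (by omega), coeff_X_pow, if_neg (by omega), mul_zero]
  coeff_zero := coeff_virCobdryPoly_zero _ _ _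
  coeff_one := by
    ext j
    rw [coeff_virCobdryPoly_one, coeff_X_pow]
    split_ifs with h
    · simp [h, add_comm]
    · simp

/-- A homogeneous cocycle of degree `n + 1` is determined by two of its coefficients. -/
theorem IsVirNormal.eq_smul_add_smul {b : ℂ} {n : ℕ} (hn : 1 ≤ n) {f g : BiPoly}
    (hf : IsVirNormal b n f) (hg : IsVirNormal b n g) (s t : ℂ)
    (h2 : (f.coeff 2).coeff (n - 1) =
      s * (g.coeff 2).coeff (n - 1) + t * virBinom b (n - 1) 2)
    (h3 : (f.coeff 3).coeff (n - 2) =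
      s * (g.coeff 3).coeff (n - 2) + if n = 1 then 0 else t * virBinom b (n - 2) 3) (x y : ℂ) :
    biEval f x y = virCobdry (b + n) b (C t * X ^ n) x y + s * biEval g x y := by
  have h0 := (hf.sub_smul_sub_smul hg (isVirNormal_virCobdryPoly b hn) s t).eq_zero ?_ ?_
  · have := congrArg (fun P : BiPoly => biEval P x y) h0
    simp only [biEval_add, biEval_biC_mul, biEval_virCobdryPoly] at this
    simp only [virCobdry, eval_mul, eval_C] at this ⊢
    simp only [biEval, eval_zero] at this ⊢
    linear_combination this
  · simp only [coeff_add, biC, coeff_C_mul, coeff_virCobdryPoly_two_le _ _ _ le_rfl, coeff_X_pow]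
    rw [h2, if_pos (by omega)]
    ring
  · simp only [coeff_add, biC, coeff_C_mul,
      coeff_virCobdryPoly_two_le _ _ _ (show 2 ≤ 3 by omega), coeff_X_pow]
    rw [h3]
    -- For `n = 1` the truncated `n - 2` is `0`, so the coefficient read is that of `∂⁰λ³`. It lies
    -- outside degree `n + 1 = 2` and is `0`, whereas `virBinom b 0 3` would be `b`.
    by_cases h1 : n = 1
    · rw [if_pos h1, if_neg (by omega)]
      ring
    · rw [if_neg h1, if_pos (by omega)]
      ring

/-- Homogeneity fixes the exponent of `∂` as `n + 2 - q - r`, whence the bound on `q + r`. The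
relations with `r = 2` are the recursion; those with `q = r` are empty by antisymmetry. The first
relation of another kind is `(q, r) = (4, 3)`, available for `n ≥ 5`. -/
theorem IsVirNormal.rel {b : ℂ} {n : ℕ} {f : BiPoly} (h : IsVirNormal b n f) {q r : ℕ}
    (hq : 2 ≤ q) (hr : 2 ≤ r) (hqr : q + r ≤ n + 2) :
    ((n + 1 - r).choose q + b * (n + 1 - r).choose (q - 1)) * (f.coeff r).coeff (n + 1 - r) -
      ((n + 1 - q).choose r + b * (n + 1 - q).choose (r - 1)) * (f.coeff q).coeff (n + 1 - q) =
    ((q + r - 1).choose (q - 1) - (q + r - 1).choose q) *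
      (f.coeff (q + r - 1)).coeff (n + 1 - (q + r - 1)) := by
  have := h.cocycle.coeff_two_le_two_le (n + 2 - (q + r)) hq hr
  rwa [virBinom, virBinom, show n + 2 - (q + r) + q - 1 = n + 1 - r by omega,
    show n + 2 - (q + r) + r - 1 = n + 1 - q by omega,
    show n + 2 - (q + r) = n + 1 - (q + r - 1) by omega] at this

/-- The obstruction to being a multiple of the coboundary of `∂ⁿ`. -/
noncomputable def virDet (b : ℂ) (n : ℕ) (f : BiPoly) : ℂ :=
  (f.coeff 2).coeff (n - 1) * virBinom b (n - 2) 3 -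
    (f.coeff 3).coeff (n - 2) * virBinom b (n - 1) 2

/-- The recursion expresses `F₄`, `F₅`, `F₆` through `F₂`, `F₃`, and the relation at `λ⁴μ³` becomes
one linear equation in `F₂`, `F₃`. The coboundary of `∂ⁿ` satisfies it, so the equation is a
multiple of `virDet = 0`; the multiple is the quadratic. -/
theorem IsVirNormal.virDet_mul {b : ℂ} {n : ℕ} {f : BiPoly} (h : IsVirNormal b n f)
    (hn : 5 ≤ n) : ((n + 2 * b) ^ 2 - 2 * (n + 2 * b) - 3 * n) * virDet b n f = 0 := by
  obtain ⟨m, rfl⟩ := Nat.exists_eq_add_of_le' hn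
  have e4 := h.rel (q := 3) (r := 2) (by omega) (by omega) (by omega)
  have e5 := h.rel (q := 4) (r := 2) (by omega) (by omega) (by omega)
  have e6 := h.rel (q := 5) (r := 2) (by omega) (by omega) (by omega)
  have e := h.rel (q := 4) (r := 3) (by omega) (by omega) (by omega)
  simp only [Nat.reduceAdd, Nat.reduceSub, Nat.reduceSubDiff, Nat.choose_one_right,
    Nat.cast_choose_two, cast_choose_three, cast_choose_four, cast_choose_five,
    virDet, virBinom] at e4 e5 e6 e ⊢
  have hm : ((m : ℂ) + 3) * (m + 2) * (m + 1) ≠ 0 := by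
    exact_mod_cast (by positivity : (m + 3) * (m + 2) * (m + 1) ≠ 0)
  push_cast at *
  generalize (m : ℂ) = μ at *
  generalize (f.coeff 2).coeff (m + 4) = F2 at *
  generalize (f.coeff 3).coeff (m + 3) = F3 at *
  generalize (f.coeff 4).coeff (m + 2) = F4 at *
  generalize (f.coeff 5).coeff (m + 1) = F5 at *
  generalize (f.coeff 6).coeff m = F6 at *
  refine (mul_eq_zero.mp ?_).resolve_left hm
  obtain ⟨β4, h4⟩ : ∃ β4, β4 = (μ + 2) * (μ + 1) / 2 + b * (μ + 2) := ⟨_, rfl⟩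
  obtain ⟨k5, h5⟩ : ∃ k5, k5 = ((μ + 1) * μ / 2 + b * (μ + 1)) / 9 := ⟨_, rfl⟩
  obtain ⟨k4, h4'⟩ : ∃ k4, k4 = (-((μ + 2) * (μ + 1) * μ / 6 + b * ((μ + 2) * (μ + 1) / 2)) -
    k5 * β4) / 2 := ⟨_, rfl⟩
  -- In `e` and `e6` the factors of `F₆` are `5` and `9`; the multiplier `-5/9` cancels `F₆`, after
  -- which `k5` and `k4` cancel `F₅` and `F₄`.
  have c := congrArg₂ (· + ·) (congrArg₂ (· + ·) e (congrArg (-5 / 9 * ·) e6))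
    (congrArg₂ (· + ·) (congrArg (k5 * ·) e5) (congrArg (k4 * ·) e4))
  beta_reduce at c
  rw [h4', h5, h4] at c
  linear_combination (-72 * (μ + 5)) * c

/-- For `n ≥ 7` the relation at `λ⁵μ⁴` is also available. If `virDet` were nonzero, its quartic in
`n`, `b` and the quadratic of `virDet_mul` would vanish together, which happens only for `n = 0` or
`n = 1`. -/
theorem IsVirNormal.virDet_eq_zero {b : ℂ} {n : ℕ} {f : BiPoly} (h : IsVirNormal b n f)
    (hn : 7 ≤ n) : virDet b n f = 0 := by
  have hq := h.virDet_mul (by omega)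
  by_contra hD
  have hq := (mul_eq_zero.mp hq).resolve_right hD
  have key : ((n : ℂ) ^ 4 + 8 * n ^ 3 * b - 24 * n ^ 3 + 24 * n ^ 2 * b ^ 2 - 144 * n ^ 2 * b +
      161 * n ^ 2 + 32 * n * b ^ 3 - 288 * n * b ^ 2 + 524 * n * b - 294 * n + 16 * b ^ 4 -
      192 * b ^ 3 + 404 * b ^ 2 - 228 * b) * virDet b n f = 0 := by
    clear hq hD
    obtain ⟨m, rfl⟩ := Nat.exists_eq_add_of_le' hn
    have e4 := h.rel (q := 3) (r := 2) (by omega) (by omega) (by omega)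
    have e5 := h.rel (q := 4) (r := 2) (by omega) (by omega) (by omega)
    have e6 := h.rel (q := 5) (r := 2) (by omega) (by omega) (by omega)
    have e7 := h.rel (q := 6) (r := 2) (by omega) (by omega) (by omega)
    have e8 := h.rel (q := 7) (r := 2) (by omega) (by omega) (by omega)
    have e := h.rel (q := 5) (r := 4) (by omega) (by omega) (by omega)
    simp only [Nat.reduceAdd, Nat.reduceSub, Nat.reduceSubDiff, Nat.choose_one_right,
      Nat.cast_choose_two, cast_choose_three, cast_choose_four, cast_choose_five,
      cast_choose_six, cast_choose_seven, virDet, virBinom] at e4 e5 e6 e7 e8 e ⊢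
    have hm : ((m : ℂ) + 5) * (m + 4) * (m + 3) * (m + 2) * (m + 1) ≠ 0 := by
      exact_mod_cast (by positivity : (m + 5) * (m + 4) * (m + 3) * (m + 2) * (m + 1) ≠ 0)
    push_cast at *
    generalize (m : ℂ) = μ at *
    generalize (f.coeff 2).coeff (m + 6) = F2 at *
    generalize (f.coeff 3).coeff (m + 5) = F3 at *
    generalize (f.coeff 4).coeff (m + 4) = F4 at *
    generalize (f.coeff 5).coeff (m + 3) = F5 at *
    generalize (f.coeff 6).coeff (m + 2) = F6 at *
    generalize (f.coeff 7).coeff (m + 1) = F7 at *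
    generalize (f.coeff 8).coeff m = F8 at *
    refine (mul_eq_zero.mp ?_).resolve_left hm
    obtain ⟨k7, h7⟩ : ∃ k7, k7 = ((μ + 1) * μ / 2 + b * (μ + 1)) / 20 := ⟨_, rfl⟩
    obtain ⟨k6, h6⟩ : ∃ k6, k6 = -k7 * ((μ + 2) * (μ + 1) / 2 + b * (μ + 2)) / 9 := ⟨_, rfl⟩
    obtain ⟨k5, h5⟩ : ∃ k5, k5 = (-((μ + 3) * (μ + 2) * (μ + 1) * μ / 24 +
      b * ((μ + 3) * (μ + 2) * (μ + 1) / 6)) -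
      k6 * ((μ + 3) * (μ + 2) / 2 + b * (μ + 3))) / 5 := ⟨_, rfl⟩
    obtain ⟨k4, h4⟩ : ∃ k4, k4 = ((μ + 4) * (μ + 3) * (μ + 2) * (μ + 1) * μ / 120 +
      b * ((μ + 4) * (μ + 3) * (μ + 2) * (μ + 1) / 24) -
      k5 * ((μ + 4) * (μ + 3) / 2 + b * (μ + 4))) / 2 := ⟨_, rfl⟩
    -- The factors of `F₈` in `e` and `e8` are `14` and `20`; then `k7`, `k6`, `k5`, `k4` cancel
    -- `F₇`, `F₆`, `F₅`, `F₄` in turn.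
    have c := congrArg₂ (· + ·) (congrArg₂ (· + ·) (congrArg₂ (· + ·) e
      (congrArg (-14 / 20 * ·) e8)) (congrArg₂ (· + ·) (congrArg (k7 * ·) e7)
      (congrArg (k6 * ·) e6))) (congrArg₂ (· + ·) (congrArg (k5 * ·) e5) (congrArg (k4 * ·) e4))
    beta_reduce at c
    rw [h4, h5, h6, h7] at c
    linear_combination (-28800 * (μ + 7)) * c
  have key := (mul_eq_zero.mp key).resolve_right hD
  -- In the variable `s = n + 2b` the quadratic reads `3n = s² - 2s`. Eliminating `n` and `b` turns
  -- the quartic into `s(s + 1)(s - 2)(s - 3)`; the roots `0, 2` give `n = 0` and `-1, 3` give `n =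
  -- 1`.
  obtain ⟨s, hs⟩ : ∃ s : ℂ, s = n + 2 * b := ⟨_, rfl⟩
  have hb : b = (s - n) / 2 := by linear_combination -hs / 2
  rw [← hs] at hq
  have hn' : (n : ℂ) = (s ^ 2 - 2 * s) / 3 := by linear_combination -hq / 3
  rw [hb, hn'] at key
  have hs4 : s * (s + 1) * ((s - 2) * (s - 3)) = 0 := by linear_combination key
  have h0 : ∀ t : ℕ, t ≤ 6 → (n : ℂ) ≠ t := by
    intro t ht
    exact_mod_cast (by omega : n ≠ t)
  have n0 := h0 0 (by omega)
  have n1 := h0 1 (by omega)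
  push_cast at n0 n1
  rcases mul_eq_zero.mp hs4 with h | h <;> rcases mul_eq_zero.mp h with h | h
  · exact n0 (by linear_combination hn' + (s - 2) / 3 * h)
  · exact n1 (by linear_combination hn' + (s - 3) / 3 * h)
  · exact n0 (by linear_combination hn' + s / 3 * h)
  · exact n1 (by linear_combination hn' + (s + 1) / 3 * h)

/-! ### Representatives of the nontrivial Virasoro classes -/

/-- Coefficients of the representatives of the nontrivial classes of degree `n + 1`. -/
noncomputable def virRep (b : ℂ) : ℕ → ℕ → ℂ
  | 2, 2 => 2
  | 2, 3 => 1
  | 3, 2 => 1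
  | 3, 3 => 1
  | 4, 2 => 4
  | 4, 3 => 6
  | 4, 4 => -1
  | 4, 5 => b
  | 5, 2 => 1
  | 5, 4 => -10
  | 5, 5 => -17
  | 5, 6 => -8
  | 6, 3 => 1
  | 6, 4 => -(2 * b + 3)
  | 6, 5 => -(3 * b)
  | 6, 6 => -(3 * b + 1)
  | 6, 7 => -(b + 9 / 28)
  | _, _ => 0

/-- The pairs `(n, b)` for which there is a nontrivial class of degree `n + 1`. -/
def IsVirSpecial (b : ℂ) (n : ℕ) : Prop :=
  n = 2 ∨ n = 3 ∨ n = 4 ∨ (n = 5 ∧ b = -4) ∨ (n = 6 ∧ b ^ 2 + 5 * b + 3 / 2 = 0)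

theorem virDet_homPoly (b : ℂ) {n : ℕ} (hn : 2 ≤ n) (F : ℕ → ℂ) :
    virDet b n (homPoly (n + 1) F) = F 2 * virBinom b (n - 2) 3 - F 3 * virBinom b (n - 1) 2 := by
  rw [virDet, coeff_homPoly, coeff_homPoly, if_pos (by omega), if_pos (by omega)]

theorem isVirNormal_virRep {b : ℂ} {n : ℕ} (hb : b ≠ 0) (h : IsVirSpecial b n) :
    IsVirNormal b n (homPoly (n + 1) (virRep b n)) ∧
      virDet b n (homPoly (n + 1) (virRep b n)) ≠ 0 := by
  have hn : 2 ≤ n := by rcases h with h | h | h | h | h <;> omega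
  refine ⟨⟨?_, fun i j hij => ?_, ?_, ?_⟩, ?_⟩
  · intro x l m
    simp only [biEval_homPoly]
    rcases h with rfl | rfl | rfl | ⟨rfl, rfl⟩ | ⟨rfl, hb6⟩
    all_goals simp [Finset.sum_range_succ, virRep]
    · ring
    · ring
    · ring
    · ring
    -- The defect of the cocycle identity is quadratic in `b`. The multiplier is its
    -- `b²`-coefficient, which comes from the `b`-linear part `-2x³y⁴ - 3x²y⁵ - 3xy⁶ - y⁷` of the
    -- representative.
    · linear_combination (m * (-2 * x ^ 3 * l ^ 4 - 3 * x ^ 2 * l ^ 5 - 3 * x * l ^ 6 - l ^ 7) +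
        l * (-2 * (x + l) ^ 3 * m ^ 4 - 3 * (x + l) ^ 2 * m ^ 5 - 3 * (x + l) * m ^ 6 - m ^ 7) -
        l * (-2 * x ^ 3 * m ^ 4 - 3 * x ^ 2 * m ^ 5 - 3 * x * m ^ 6 - m ^ 7) -
        m * (-2 * (x + m) ^ 3 * l ^ 4 - 3 * (x + m) ^ 2 * l ^ 5 - 3 * (x + m) * l ^ 6 - l ^ 7)) *
        hb6
  · rw [coeff_homPoly, if_neg hij]
  · ext j
    rw [coeff_homPoly]
    rcases h with rfl | rfl | rfl | ⟨rfl, -⟩ | ⟨rfl, -⟩ <;> simp [virRep]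
  · ext j
    rw [coeff_homPoly]
    rcases h with rfl | rfl | rfl | ⟨rfl, -⟩ | ⟨rfl, -⟩ <;> simp [virRep]
  · rw [virDet_homPoly b hn]
    rcases h with rfl | rfl | rfl | ⟨rfl, rfl⟩ | ⟨rfl, hb6⟩
    -- The determinants for `n = 2, …, 6` are `-1`, `-2`, `-20`, `-30` and `-(6b + 15)`. The last is
    -- nonzero because `b = -5/2` is not a root of `b² + 5b + 3/2`.
    all_goals norm_num [virRep, virBinom, Nat.choose]
    · intro h0
      have : (-1 : ℂ) = 0 := by linear_combination h0
      norm_num at this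
    · intro h0
      have : (20 : ℂ) = 0 := by linear_combination -h0
      norm_num at this
    · intro h0
      have : (-19 / 4 : ℂ) = 0 := by linear_combination hb6 + (b + 5 / 2) / 6 * h0
      norm_num at this

/-- These are the `λ²` and `λ³` coefficients of the coboundary of `∂ⁿ`. Eliminating `b` between them
leaves a positive integer. Thus `virDet = 0` does mean proportional to that coboundary. -/
theorem virBinom_ne_zero_or {b : ℂ} {n : ℕ} (hn : 2 ≤ n) :
    virBinom b (n - 1) 2 ≠ 0 ∨ virBinom b (n - 2) 3 ≠ 0 := by
  obtain ⟨m, rfl⟩ := Nat.exists_eq_add_of_le' hn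
  by_contra! h
  obtain ⟨h2, h3⟩ := h
  simp only [virBinom, Nat.reduceSubDiff, Nat.cast_choose_two, cast_choose_three,
    Nat.choose_one_right, Nat.add_sub_cancel, show m + 1 + 2 - 1 = m + 2 by omega] at h2 h3
  push_cast at h2 h3
  have : ((m : ℂ) + 2) * (m + 1) * (m + 3) = 0 := by
    linear_combination 6 * (m + 1) * h2 - 12 * h3
  exact absurd this (by exact_mod_cast (by positivity : (m + 2) * (m + 1) * (m + 3) ≠ 0))

/-- Classification of the normal cocycles. -/
theorem IsVirNormal.classification {b : ℂ} (hb : b ≠ 0) {n : ℕ} (hn : 1 ≤ n) {f : BiPoly}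
    (h : IsVirNormal b n f) :
    (∃ φ : ℂ[X], ∀ x y, biEval f x y = virCobdry (b + n) b φ x y) ∨
      (IsVirSpecial b n ∧ ∃ (φ : ℂ[X]) (c : ℂ), ∀ x y,
        biEval f x y = virCobdry (b + n) b φ x y +
          c * biEval (homPoly (n + 1) (virRep b n)) x y) := by
  rcases Nat.eq_or_lt_of_le hn with rfl | hn2
  -- In degree `2` only `λ²` is left, and the coboundary of `∂` is `bλ²`.
  · refine Or.inl ⟨C ((f.coeff 2).coeff 0 / b) * X ^ 1, fun x y => ?_⟩
    have := h.eq_smul_add_smul le_rfl h 0 ((f.coeff 2).coeff 0 / b)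
      (by simp [virBinom_zero_left b one_le_two, hb]) (by simp [h.hom 3 0 (by omega)]) x y
    rwa [zero_mul, add_zero] at this
  have hn1 : n ≠ 1 := by omega
  by_cases hs : IsVirSpecial b n
  · obtain ⟨hg, hdet⟩ := isVirNormal_virRep hb hs
    refine Or.inr ⟨hs, ?_⟩
    set g := homPoly (n + 1) (virRep b n)
    -- Cramer's rule for the coordinates of `(F₂, F₃)` in the basis given by the representative and
    -- the coboundary of `∂ⁿ`.
    refine ⟨_, virDet b n f / virDet b n g, h.eq_smul_add_smul hn hg _
      (((f.coeff 3).coeff (n - 2) * (g.coeff 2).coeff (n - 1) -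
        (f.coeff 2).coeff (n - 1) * (g.coeff 3).coeff (n - 2)) / virDet b n g) ?_ ?_⟩
    · field_simp
      simp only [virDet]
      ring
    · rw [if_neg hn1]
      field_simp
      simp only [virDet]
      ring
  · have hdet : virDet b n f = 0 := by
      rcases Nat.lt_or_ge n 7 with h7 | h7
      swap
      · exact h.virDet_eq_zero h7
      have h5 : 5 ≤ n := by
        by_contra h5
        exact hs (by unfold IsVirSpecial; omega)
      refine (mul_eq_zero.mp (h.virDet_mul h5)).resolve_left fun h0 => hs ?_
      -- The quadratic is `4b(b + 4)` for `n = 5` and `4(b² + 5b + 3/2)` for `n = 6`.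
      obtain rfl | rfl : n = 5 ∨ n = 6 := by omega
      · have : b * (b + 4) = 0 := by
          push_cast at h0
          linear_combination h0 / 4
        have := (mul_eq_zero.mp this).resolve_left hb
        exact Or.inr (Or.inr (Or.inr (Or.inl ⟨rfl, by linear_combination this⟩)))
      · push_cast at h0
        exact Or.inr (Or.inr (Or.inr (Or.inr ⟨rfl, by linear_combination h0 / 4⟩)))
    unfold virDet at hdet
    refine Or.inl ?_
    obtain ⟨t, h2, h3⟩ : ∃ t, (f.coeff 2).coeff (n - 1) = t * virBinom b (n - 1) 2 ∧
        (f.coeff 3).coeff (n - 2) = t * virBinom b (n - 2) 3 := by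
      rcases virBinom_ne_zero_or (b := b) hn2 with h0 | h0
      · refine ⟨(f.coeff 2).coeff (n - 1) / virBinom b (n - 1) 2, by field_simp, ?_⟩
        field_simp
        linear_combination -hdet
      · refine ⟨(f.coeff 3).coeff (n - 2) / virBinom b (n - 2) 3, ?_, by field_simp⟩
        field_simp
        linear_combination hdet
    refine ⟨C t * X ^ n, fun x y => ?_⟩
    have := h.eq_smul_add_smul hn h 0 t (by simp [h2]) (by simp [h3, hn1]) x y
    rwa [zero_mul, add_zero] at this

/-- The representatives are not coboundaries. -/
theorem virRep_not_cobdry {b : ℂ} (hb : b ≠ 0) {n : ℕ} (h : IsVirSpecial b n) {φ : ℂ[X]} {c : ℂ}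
    (hφ : ∀ x y, c * biEval (homPoly (n + 1) (virRep b n)) x y = virCobdry (b + n) b φ x y) :
    c = 0 := by
  have hn : 2 ≤ n := by rcases h with h | h | h | h | h <;> omega
  have hdet := (isVirNormal_virRep hb h).2
  have key : biC c * homPoly (n + 1) (virRep b n) = virCobdryPoly (b + n) b φ :=
    BiPoly.ext_biEval fun x y => by rw [biEval_biC_mul, biEval_virCobdryPoly, hφ]
  have h2 := congrArg (fun P : BiPoly => (P.coeff 2).coeff (n - 1)) key
  have h3 := congrArg (fun P : BiPoly => (P.coeff 3).coeff (n - 2)) key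
  simp only [biC, coeff_C_mul, coeff_virCobdryPoly_two_le _ _ _ (le_refl 2),
    coeff_virCobdryPoly_two_le _ _ _ (show 2 ≤ 3 by omega)] at h2 h3
  rw [show n - 1 + 2 - 1 = n by omega] at h2
  rw [show n - 2 + 3 - 1 = n by omega] at h3
  -- Both coefficients of the coboundary are multiples of the same `φₙ`, so its determinant vanishes
  -- whatever `φ` is.
  have : c * virDet b n (homPoly (n + 1) (virRep b n)) = 0 := by
    unfold virDet
    linear_combination virBinom b (n - 2) 3 * h2 - virBinom b (n - 1) 2 * h3
  exact (mul_eq_zero.mp this).resolve_right hdet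

/-- When `a = b`, a coboundary has neither a `λ⁰` term nor a `∂⁰λ` term, the latter having the
factor `0 + b - a`. -/
theorem affine_not_cobdry {a c₀ c₁ : ℂ} {φ : ℂ[X]}
    (hφ : ∀ x y, c₀ + c₁ * y = virCobdry a a φ x y) : c₀ = 0 ∧ c₁ = 0 := by
  have key : biC c₀ + biC c₁ * biL = virCobdryPoly a a φ :=
    BiPoly.ext_biEval fun x y => by
      rw [biEval_virCobdryPoly, ← hφ]
      simp [biEval, biC, biL]
  have h0 := congrArg (fun P : BiPoly => (P.coeff 0).coeff 0) key
  have h1 := congrArg (fun P : BiPoly => (P.coeff 1).coeff 0) key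
  simp only [coeff_virCobdryPoly_zero, coeff_virCobdryPoly_one] at h0 h1
  exact ⟨by simpa [biC, biL] using h0, by simpa [biC, biL, coeff_C] using h1⟩

/-! ### From extensions to cocycles -/

namespace ConformalModule

variable {V : Type u} [AddCommGroup V] [Module ℂ V] (S : ConformalModule svAlgebra V)

theorem act_smul_svGen (l : ℂ) (p : ℂ[X]) (s : SVGen) (v : V) :
    S.act l (p • svGen s) v = p.eval (-l) • S.act l (svGen s) v := by
  induction p using Polynomial.induction_on' with
  | add p q hp hq => simp [add_smul, hp, hq]
  | monomial n c =>
    rw [← C_mul_X_pow_eq_monomial, mul_smul, svC_smul, map_smul, LinearMap.smul_apply, eval_mul,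
      eval_C, mul_smul]
    congr 1
    induction n with
    | zero => simp
    | succ n ih =>
      have := S.act_D l ((X : ℂ[X]) ^ n • svGen s) v
      rw [ih] at this
      rw [pow_succ', mul_smul]
      refine this.trans ?_
      simp [mul_smul]

theorem act_eq_sum (l : ℂ) (a : SVCarrier) (v : V) :
    S.act l a v = ∑ s, (a s).eval (-l) • S.act l (svGen s) v := by
  have ha : a = ∑ s, a s • svGen s := by
    funext t
    rw [Finset.sum_apply, Finset.sum_eq_single t]
    · simp [svGen]
    · intro s _ hs
      simp [svGen, Pi.single_eq_of_ne hs.symm]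
    · simp
  conv_lhs => rw [ha]
  rw [map_sum, LinearMap.sum_apply]
  exact Finset.sum_congr rfl fun s _ => S.act_smul_svGen l (a s) s v

theorem act_aeval (l : ℂ) (a : SVCarrier) (q : ℂ[X]) (v : V) :
    S.act l a (aeval S.D q v) = aeval S.D (q.comp (X + C l)) (S.act l a v) := by
  induction q using Polynomial.induction_on' with
  | add p q hp hq => simp [hp, hq]
  | monomial n c =>
    rw [← C_mul_X_pow_eq_monomial]
    simp only [map_mul, mul_comp, C_comp, pow_comp, X_comp, aeval_C, map_pow, aeval_X,
      Module.End.mul_apply, Module.algebraMap_end_apply, map_smul, map_add]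
    congr 1
    induction n with
    | zero => simp
    | succ n ih =>
      have := S.D_act l a ((S.D ^ n) v)
      rw [pow_succ', pow_succ', Module.End.mul_apply, Module.End.mul_apply, ← ih,
        LinearMap.add_apply, Module.algebraMap_end_apply]
      rw [sub_eq_iff_eq_add] at this
      rw [this, neg_smul]
      abel

variable {W : Type v} [AddCommGroup W] [Module ℂ W] {S} {T : ConformalModule svAlgebra W}

theorem IsHom.map_aeval {ψ : V →ₗ[ℂ] W} (h : S.IsHom T ψ) (q : ℂ[X]) (v : V) :
    ψ (aeval S.D q v) = aeval T.D q (ψ v) := by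
  induction q using Polynomial.induction_on' with
  | add p q hp hq => simp [hp, hq]
  | monomial n c =>
    rw [← C_mul_X_pow_eq_monomial]
    simp only [map_mul, aeval_C, map_pow, aeval_X, Module.End.mul_apply,
      Module.algebraMap_end_apply, map_smul]
    congr 1
    induction n with
    | zero => simp
    | succ n ih => rw [pow_succ', pow_succ', Module.End.mul_apply, Module.End.mul_apply, h.1, ih]

end ConformalModule

theorem svModule_aeval (α β Δ : ℂ) (q p : ℂ[X]) : aeval (svModule α β Δ).D q p = q * p := by
  change aeval (LinearMap.mulLeft ℂ (X : ℂ[X])) q p = q * p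
  induction q using Polynomial.induction_on' with
  | add r q hr hq => simp [hr, hq, add_mul]
  | monomial n c =>
    rw [← C_mul_X_pow_eq_monomial]
    simp [LinearMap.pow_mulLeft, smul_eq_C_mul, mul_assoc]

/-- The contribution of the cocycle `c` to `a_λ v`. -/
noncomputable def cocycleSum (c : SVGen → BiPoly) (l : ℂ) (a : SVCarrier) : ℂ[X] :=
  ∑ s, C ((a s).eval (-l)) * (c s).eval (C l)

/-- The four polynomials as a family. -/
def cocycleFamily (f g h k : BiPoly) : SVGen → BiPoly
  | .L => f
  | .M => g
  | .Y => h
  | .N => k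

namespace ConformalModule.Extension

variable {α β Δ α' β' Δ' : ℂ} (E : Extension.{0, 0, 0, x} (svModule α' β' Δ') (svModule α β Δ))

/-- The parametrization of the extension by pairs of polynomials. -/
noncomputable def param (v : E.carrier) : ℂ[X] × ℂ[X] →ₗ[ℂ] E.carrier :=
  E.i.coprod ((LinearMap.applyₗ v).comp (aeval E.str.D).toLinearMap)

theorem param_apply (v : E.carrier) (p q : ℂ[X]) :
    E.param v (p, q) = E.i p + aeval E.str.D q v := rfl

/-- `v` realizes the cocycle `c`. -/
def Realizes (v : E.carrier) (c : SVGen → BiPoly) : Prop :=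
  E.p v = 1 ∧ ∀ l s, E.str.act l (svGen s) v =
    aeval E.str.D (svCoeff α β Δ l s) v + E.i ((c s).eval (C l))

theorem hasCocycle_iff {f g h k : BiPoly} :
    HasCocycle E f g h k ↔ ∃ v, E.Realizes v (cocycleFamily f g h k) := by
  refine exists_congr fun v => and_congr_right fun _ => ⟨fun H l s => ?_, fun H l => ?_⟩
  · obtain ⟨h1, h2, h3, h4⟩ := H l
    cases s <;> simp [svCoeff, cocycleFamily, h1, h2, h3, h4]
    module
  · refine ⟨?_, ?_, ?_, ?_⟩ <;> rw [H l] <;>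
      simp [svCoeff, cocycleFamily]
    module

theorem p_i (p : ℂ[X]) : E.p (E.i p) = 0 := (E.exact _).mpr ⟨p, rfl⟩

theorem aeval_i (q p : ℂ[X]) : aeval E.str.D q (E.i p) = E.i (q * p) := by
  rw [← E.i_isHom.map_aeval, svModule_aeval]

variable {E} {v : E.carrier} {c : SVGen → BiPoly}

theorem p_param (hv : E.p v = 1) (p q : ℂ[X]) : E.p (E.param v (p, q)) = q := by
  rw [param_apply, map_add, p_i, E.p_isHom.map_aeval, hv, svModule_aeval, zero_add, mul_one]

/-- Subtracting from `z` the multiple of `v` with the same image leaves an element of the kernel of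
`p`, that is, of the image of `i`. So `E` is free over `ℂ[∂]` on the two generators. -/
theorem param_bijective (hv : E.p v = 1) : Function.Bijective (E.param v) := by
  constructor
  · rw [injective_iff_map_eq_zero]
    rintro ⟨p, q⟩ h
    have hq : q = 0 := by rw [← p_param hv p q, h, map_zero]
    subst hq
    rw [param_apply, map_zero, LinearMap.zero_apply, add_zero] at h
    rw [(injective_iff_map_eq_zero E.i).mp E.injective p h]
    rfl
  · intro z
    obtain ⟨p, hp⟩ := (E.exact (z - aeval E.str.D (E.p z) v)).mp (by
      rw [map_sub, E.p_isHom.map_aeval, hv, svModule_aeval, mul_one, sub_self])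
    exact ⟨(p, E.p z), by rw [param_apply, hp, sub_add_cancel]⟩

theorem D_param (v : E.carrier) (z : ℂ[X] × ℂ[X]) :
    E.str.D (E.param v z) = E.param v (X * z.1, X * z.2) := by
  obtain ⟨p, q⟩ := z
  simp only [param_apply, map_add, map_mul, aeval_X, Module.End.mul_apply, ← E.aeval_i]

theorem act_param (hv : E.Realizes v c) (l : ℂ) (a : SVCarrier) (z : ℂ[X] × ℂ[X]) :
    E.str.act l a (E.param v z) = E.param v
      (svAct α' β' Δ' l a z.1 + z.2.comp (X + C l) * cocycleSum c l a, svAct α β Δ l a z.2) := by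
  obtain ⟨p, q⟩ := z
  have h1 : E.str.act l a (E.i p) = E.i (svAct α' β' Δ' l a p) := (E.i_isHom.2 l a p).symm
  have h2 : E.str.act l a v = E.i (cocycleSum c l a) +
      aeval E.str.D (∑ s, C ((a s).eval (-l)) * svCoeff α β Δ l s) v := by
    rw [act_eq_sum, cocycleSum, map_sum, map_sum, LinearMap.sum_apply, ← Finset.sum_add_distrib]
    refine Finset.sum_congr rfl fun s _ => ?_
    rw [hv.2, smul_add, add_comm, ← smul_eq_C_mul, ← smul_eq_C_mul, map_smul, map_smul,
      LinearMap.smul_apply]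
  simp only [param_apply]
  rw [map_add, h1, act_aeval, h2, map_add, E.aeval_i, ← Module.End.mul_apply, ← map_mul,
    map_add E.i, Finset.mul_sum]
  simp only [svAct, mul_left_comm, mul_assoc]
  rw [add_assoc]

/-- The module axiom for two generators applied to `v`, read off in the submodule component of the
coordinates `param`. -/
theorem cocycle_rel (hv : E.Realizes v c) (l m : ℂ) (s t : SVGen) :
    svAct α' β' Δ' l (svGen s) ((c t).eval (C m)) +
      (svCoeff α β Δ m t).comp (X + C l) * (c s).eval (C l) -
      (svAct α' β' Δ' m (svGen t) ((c s).eval (C l)) +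
        (svCoeff α β Δ l s).comp (X + C m) * (c t).eval (C m)) =
      cocycleSum c (l + m) (svTable l s t) := by
  have hsum : ∀ l s, cocycleSum c l (svGen s) = (c s).eval (C l) := by
    intro l s
    rw [cocycleSum, Finset.sum_eq_single s]
    · simp [svGen]
    · intro t _ ht
      simp [svGen, Pi.single_eq_of_ne ht]
    · simp
  have hbr : svAlgebra.bracket l (svGen s) (svGen t) = svTable l s t := by
    change svBracket l (svGen s) (svGen t) = _
    cases s <;> cases t <;> simp [svBracket, svGen_sum, svGen]
  have key := E.str.act_bracket l m (svGen s) (svGen t) v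
  have hv' : v = E.param v (0, 1) := by simp [param_apply]
  have h1 : ∀ l s, E.str.act l (svGen s) v = E.param v ((c s).eval (C l), svCoeff α β Δ l s) := by
    intro l s
    rw [hv.2, param_apply, add_comm]
  have h2 : ∀ a, E.str.act (l + m) a v = E.param v
      (cocycleSum c (l + m) a, svAct α β Δ (l + m) a 1) := by
    intro a
    conv_lhs => rw [hv', act_param hv]
    simp [svAct]
  rw [h1, h1, act_param hv, act_param hv, h2, hbr, hsum, hsum, ← map_sub] at key
  exact congrArg Prod.fst ((param_bijective hv.1).1 key)

/-- In the coordinates `param`, the action and `∂` depend only on `c`, so the identity of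
coordinates is an equivalence. This gives uniqueness, and also triviality when `c = 0`. -/
theorem equivalent_of_realizes {E' : Extension.{0, 0, 0, y} (svModule α' β' Δ') (svModule α β Δ)}
    {v' : E'.carrier} (hv : E.Realizes v c) (hv' : E'.Realizes v' c) : E.Equivalent E' := by
  let Φ := LinearEquiv.ofBijective (E.param v) (param_bijective hv.1)
  have hΦ : ∀ z, Φ.symm (E.param v z) = z := Φ.symm_apply_apply
  have hs : ∀ z, ∃ w, E.param v w = z := (param_bijective hv.1).2
  refine ⟨(E'.param v').comp Φ.symm.toLinearMap, ⟨fun z => ?_, fun l a z => ?_⟩, fun p => ?_,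
    fun z => ?_⟩
  · obtain ⟨w, rfl⟩ := hs z
    simp only [LinearMap.comp_apply, LinearEquiv.coe_coe, D_param, hΦ]
  · obtain ⟨w, rfl⟩ := hs z
    simp only [LinearMap.comp_apply, LinearEquiv.coe_coe, act_param hv, act_param hv', hΦ]
  · have : E.i p = E.param v (p, 0) := by simp [param_apply]
    rw [this, LinearMap.comp_apply, LinearEquiv.coe_coe, hΦ]
    simp [param_apply]
  · obtain ⟨⟨p, q⟩, rfl⟩ := hs z
    rw [LinearMap.comp_apply, LinearEquiv.coe_coe, hΦ, p_param hv.1, p_param hv'.1]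

theorem Realizes.of_equivalent
    {E' : Extension.{0, 0, 0, y} (svModule α' β' Δ') (svModule α β Δ)}
    (hv : E.Realizes v c) (h : E.Equivalent E') : ∃ v' : E'.carrier, E'.Realizes v' c := by
  obtain ⟨ψ, hψ, hi, hp⟩ := h
  refine ⟨ψ v, by rw [hp, hv.1], fun l s => ?_⟩
  rw [← hψ.2, hv.2, map_add, hψ.map_aeval, hi]

end ConformalModule.Extension

theorem PolynomialFamily.eval_biPoly (P : BiPoly) : PolynomialFamily fun l => P.eval (C l) := by
  induction P using Polynomial.induction_on' with
  | add P Q hP hQ => simpa using hP.add hQ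
  | monomial n q =>
    refine ⟨Finsupp.single n q, fun l => ?_⟩
    simp only [eval_monomial]
    rw [Finsupp.sum_single_index (by simp), ← C_pow, smul_eq_C_mul, mul_comm]

theorem PolynomialFamily.neg_smul_const {V : Type u} [AddCommGroup V] [Module ℂ V]
    (c : ℂ) (v : V) : PolynomialFamily fun l => -((c * l) • v) :=
  ⟨Finsupp.single 1 (-(c • v)), fun l => by
    rw [Finsupp.sum_single_index (by simp), pow_one, smul_neg, smul_smul, mul_comm]⟩

theorem PolynomialFamily.const {V : Type u} [AddCommGroup V] [Module ℂ V]
    (v : V) : PolynomialFamily fun _ => v :=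
  ⟨Finsupp.single 0 v, fun l => by rw [Finsupp.sum_single_index (by simp)]; simp⟩

/-- The translate `f(∂ - α, λ)`. -/
noncomputable def biShift (α : ℂ) (f : BiPoly) : BiPoly := f.map (compRingHom (X - C α))

theorem biEval_biShift (α : ℂ) (f : BiPoly) (x y : ℂ) :
    biEval (biShift α f) x y = biEval f (x - α) y := by
  have h : (C y : ℂ[X]) = compRingHom (X - C α) (C y) := by simp
  rw [biEval, biEval, biShift, h, eval_map, eval₂_at_apply]
  simp [eval_comp]

namespace ConformalModule.Extension

variable {α β Δ α' β' Δ' : ℂ} {E : Extension.{0, 0, 0, x} (svModule α' β' Δ') (svModule α β Δ)}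

/-- A polynomial family in `E` with values in the submodule comes from a polynomial. -/
theorem exists_biPoly_of_p_eq_zero {φ : ℂ → E.carrier} (h : PolynomialFamily φ)
    (h0 : ∀ l, E.p (φ l) = 0) : ∃ P : BiPoly, ∀ l, φ l = E.i (P.eval (C l)) := by
  obtain ⟨c, hc⟩ := h
  have hz : (∑ n ∈ c.support, monomial n (E.p (c n)) : BiPoly) = 0 := by
    refine BiPoly.ext_eval fun l => ?_
    have := h0 l
    rw [hc, Finsupp.sum, map_sum] at this
    rw [eval_zero, ← this, eval_finsetSum]
    refine Finset.sum_congr rfl fun n _ => ?_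
    rw [eval_monomial, map_smul, smul_eq_C_mul, C_pow, mul_comm]
  have hpn : ∀ n, E.p (c n) = 0 := by
    intro n
    have := congrArg (fun P : BiPoly => P.coeff n) hz
    simp only [finsetSum_coeff, coeff_monomial, Finset.sum_ite_eq', coeff_zero] at this
    by_cases hn : n ∈ c.support
    · simpa [hn] using this
    · rw [Finsupp.notMem_support_iff.mp hn, map_zero]
  choose d hd using fun n => (E.exact (c n)).mp (hpn n)
  refine ⟨∑ n ∈ c.support, monomial n (d n), fun l => ?_⟩
  rw [hc, Finsupp.sum, eval_finsetSum, map_sum]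
  refine Finset.sum_congr rfl fun n _ => ?_
  rw [eval_monomial, ← C_pow, mul_comm, ← smul_eq_C_mul, map_smul, hd]

variable (E) in
-- For any lift `v`, the error `s_λ v - (s_λ 1)(∂) v` is polynomial in `λ` and is killed by `p`,
-- hence comes from a polynomial in the submodule.
theorem exists_realizes : ∃ v c, E.Realizes v c := by
  obtain ⟨v, hv⟩ := E.surjective 1
  have : ∀ s, ∃ P : BiPoly, ∀ l, E.str.act l (svGen s) v -
      aeval E.str.D (svCoeff α β Δ l s) v = E.i (P.eval (C l)) := by
    intro s
    refine exists_biPoly_of_p_eq_zero ?_ fun l => ?_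
    · have h1 : PolynomialFamily fun l => -aeval E.str.D (svCoeff α β Δ l s) v := by
        cases s with
        | L =>
          convert (PolynomialFamily.const (-(E.str.D v + α • v))).add
            (PolynomialFamily.neg_smul_const Δ v) using 2 with l
          simp [svCoeff]
          module
        | N => exact .const (-aeval E.str.D (svCoeff α β Δ 0 .N) v)
        | M => exact .const (-aeval E.str.D (svCoeff α β Δ 0 .M) v)
        | Y => exact .const (-aeval E.str.D (svCoeff α β Δ 0 .Y) v)
      simpa only [sub_eq_add_neg] using (E.str.polynomial (svGen s) v).add h1
    · rw [map_sub, E.p_isHom.2, E.p_isHom.map_aeval, hv, svModule_aeval, mul_one, sub_eq_zero]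
      change svAct α β Δ l (svGen s) 1 = _
      rw [svAct, Finset.sum_eq_single s]
      · simp [svGen]
      · intro t _ ht
        simp [svGen, Pi.single_eq_of_ne ht]
      · simp
  choose c hc using this
  exact ⟨v, c, hv, fun l s => by rw [← hc]; abel⟩

end ConformalModule.Extension

theorem svAct_svGen (α β Δ l : ℂ) (s : SVGen) (p : ℂ[X]) :
    svAct α β Δ l (svGen s) p = p.comp (X + C l) * svCoeff α β Δ l s := by
  rw [svAct, Finset.sum_eq_single s]
  · simp [svGen]
  · intro t _ ht
    simp [svGen, Pi.single_eq_of_ne ht]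
  · simp

/-- Compatibility of `f` and `k` with the brackets `[L_λ L]` and `[L_λ N]`. -/
def IsSVCocycle (α Δ Δ' : ℂ) (f k : BiPoly) : Prop :=
  IsVirCocycle Δ Δ' (biEval (biShift α f)) ∧ IsCurCocycle Δ Δ' (biEval (biShift α k))

namespace ConformalModule.Extension

variable {α Δ Δ' : ℂ} {E : Extension.{0, 0, 0, x} (svModule α 0 Δ') (svModule α 0 Δ)}

theorem Realizes.isSVCocycle {v : E.carrier} {c : SVGen → BiPoly} (hv : E.Realizes v c) :
    c .M = 0 ∧ c .Y = 0 ∧ IsSVCocycle α Δ Δ' (c .L) (c .N) := by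
  have h := fun l m s t x => congrArg (eval x) (cocycle_rel hv l m s t)
  simp only [cocycleSum, svGen_sum, svAct_svGen] at h
  refine ⟨BiPoly.ext_biEval fun x y => ?_, BiPoly.ext_biEval fun x y => ?_, fun x l m => ?_,
    fun x l m => ?_⟩
  -- With `N` at `λ = y` and `M` at `0`, all terms on the left vanish since `N` and `M` act by zero
  -- on both ends; `[N_λ M] = 2M` leaves `2g = 0`. The same argument with `Y` gives `h = 0`.
  · have := h y 0 .N .M x
    simp [svTable, svGen, svCoeff] at this
    simp [biEval, this]
  · have := h y 0 .N .Y x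
    simp [svTable, svGen, svCoeff] at this
    simp [biEval, this]
  · have := h l m .L .L (x - α)
    simp [svTable, svGen, svCoeff, eval_comp] at this
    simp only [biEval_biShift]
    simp only [biEval, sub_add_eq_add_sub, C_add] at this ⊢
    linear_combination this
  · have := h l m .L .N (x - α)
    simp [svTable, svGen, svCoeff, eval_comp] at this
    simp only [biEval_biShift]
    simp only [biEval, sub_add_eq_add_sub, C_add] at this ⊢
    linear_combination this

end ConformalModule.Extension

/-! ### From cocycles to extensions -/

namespace IsSVCocycle

variable {α Δ Δ' : ℂ} {f k : BiPoly}

theorem cocycleSum_eq (f k : BiPoly) (l : ℂ) (a : SVCarrier) :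
    cocycleSum (cocycleFamily f 0 0 k) l a =
      C ((a .L).eval (-l)) * f.eval (C l) + C ((a .N).eval (-l)) * k.eval (C l) := by
  simp [cocycleSum, svGen_sum, cocycleFamily]

theorem cocycleSum_polynomial (f k : BiPoly) (a : SVCarrier) (q : ℂ[X]) :
    PolynomialFamily fun l => q.comp (X + C l) * cocycleSum (cocycleFamily f 0 0 k) l a := by
  have hc : ∀ (p : ℂ[X]) (l : ℂ), p.comp (-C l) = C (p.eval (-l)) := by
    intro p l
    rw [← C_neg, comp_C]
  convert PolynomialFamily.eval_biPoly (q.eval₂ (C.comp C) (C X + X) *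
    ((a .L).eval₂ (C.comp C) (-X) * f + (a .N).eval₂ (C.comp C) (-X) * k)) using 2 with l
  rw [cocycleSum_eq]
  simp only [eval_mul, eval_add, sv_eval_eval₂, eval_neg, eval_X, eval_C, hc]

theorem vir_eval (h : IsSVCocycle α Δ Δ' f k) (l m x : ℂ) :
    (x + α + l + Δ * m) * (f.eval (C l)).eval x + (x + α + Δ' * l) * (f.eval (C m)).eval (x + l) -
      (x + α + m + Δ * l) * (f.eval (C m)).eval x -
      (x + α + Δ' * m) * (f.eval (C l)).eval (x + m) =
      (l - m) * (f.eval (C (l + m))).eval x := by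
  have := h.1 (x + α) l m
  simp only [biEval_biShift] at this
  simp only [biEval, add_right_comm x α, add_sub_cancel_right] at this
  linear_combination this

theorem cur_eval (h : IsSVCocycle α Δ Δ' f k) (l m x : ℂ) :
    (x + α + Δ' * l) * (k.eval (C m)).eval (x + l) - (x + α + m + Δ * l) * (k.eval (C m)).eval x =
      -m * (k.eval (C (l + m))).eval x := by
  have := h.2 (x + α) l m
  simp only [biEval_biShift] at this
  simp only [biEval, add_right_comm x α, add_sub_cancel_right] at this
  linear_combination this

/-- The cocycle sees only the `L` and `N` components, and the `N`, `N` contribution vanishes. The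
`L`, `L` part is the Virasoro identity; the `L`, `N` and `N`, `L` parts are the current identity,
used once with `l` and `m` exchanged. -/
theorem bracket (h : IsSVCocycle α Δ Δ' f k) (l m : ℂ) (a b : SVCarrier) (q : ℂ[X]) :
    svAct α 0 Δ' l a (q.comp (X + C m) * cocycleSum (cocycleFamily f 0 0 k) m b) +
      (svAct α 0 Δ m b q).comp (X + C l) * cocycleSum (cocycleFamily f 0 0 k) l a -
      (svAct α 0 Δ' m b (q.comp (X + C l) * cocycleSum (cocycleFamily f 0 0 k) l a) +
      (svAct α 0 Δ l a q).comp (X + C m) * cocycleSum (cocycleFamily f 0 0 k) m b) =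
      q.comp (X + C (l + m)) *
        cocycleSum (cocycleFamily f 0 0 k) (l + m) (svBracket l a b) := by
  have hL : svBracket l a b .L =
      C ((a .L).eval (-l)) * (b .L).comp (X + C l) * (X + C (2 * l)) := by
    simp [svBracket, svGen_sum, svTable, svGen]
  have hN : svBracket l a b .N =
      C ((a .L).eval (-l)) * (b .N).comp (X + C l) * (X + C l)
      + C ((a .N).eval (-l)) * (b .L).comp (X + C l) * C l := by
    simp [svBracket, svGen_sum, svTable, svGen]
  refine Polynomial.funext fun x => ?_
  have h3 : -(l + m) + l = -m := by ring
  simp only [svAct_eq, cocycleSum_eq, hL, hN, mul_comp, add_comp, X_comp, C_comp, eval_sub,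
    eval_mul, eval_add, eval_X, eval_C, eval_comp, h3, add_right_comm x m l, C_0, mul_zero,
    add_zero]
  simp only [add_assoc x l m]
  have h1 := h.vir_eval l m x
  have h2 := h.cur_eval l m x
  have h4 := h.cur_eval m l x
  rw [add_comm m l] at h4
  linear_combination q.eval (x + (l + m)) * ((a .L).eval (-l) * (b .L).eval (-m) * h1 +
    (a .L).eval (-l) * (b .N).eval (-m) * h2 - (a .N).eval (-l) * (b .L).eval (-m) * h4)

/-- The module structure on `ℂ[∂]v' ⊕ ℂ[∂]v` defined by a cocycle. -/
noncomputable def module (h : IsSVCocycle α Δ Δ' f k) :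
    ConformalModule svAlgebra (ℂ[X] × ℂ[X]) where
  D := (LinearMap.mulLeft ℂ X).prodMap (LinearMap.mulLeft ℂ X)
  act l := LinearMap.mk₂ ℂ (fun a z => ((svModule α 0 Δ').act l a z.1 +
      z.2.comp (X + C l) * cocycleSum (cocycleFamily f 0 0 k) l a, (svModule α 0 Δ).act l a z.2))
    (by
      intro a a' z
      simp only [map_add, LinearMap.add_apply, cocycleSum_eq, Pi.add_apply, eval_add,
        Prod.mk_add_mk, Prod.mk.injEq, and_true]
      ring)
    (by
      intro t a z
      simp only [map_smul, LinearMap.smul_apply, cocycleSum_eq, Pi.smul_apply, eval_smul,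
        smul_eq_mul, C_mul, Prod.smul_mk, Prod.mk.injEq, and_true]
      rw [smul_eq_C_mul, smul_eq_C_mul]
      ring)
    (by
      intro a z z'
      simp only [map_add, Prod.fst_add, Prod.snd_add, add_comp, Prod.mk_add_mk, Prod.mk.injEq,
        and_true]
      ring)
    (by
      intro t a z
      simp only [map_smul, Prod.smul_fst, Prod.smul_snd, smul_comp, Prod.smul_mk, smul_add,
        smul_mul_assoc])
  polynomial a z := by
    have h1 := (((svModule α 0 Δ').polynomial a z.1).add (cocycleSum_polynomial f k a z.2)).map
      (LinearMap.inl ℂ ℂ[X] ℂ[X])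
    have h2 := ((svModule α 0 Δ).polynomial a z.2).map (LinearMap.inr ℂ ℂ[X] ℂ[X])
    simpa using h1.add h2
  act_bracket l m a b z := by
    refine Prod.ext ?_ ((svModule α 0 Δ).act_bracket l m a b z.2)
    have h1 := (svModule α 0 Δ').act_bracket l m a b z.1
    have h2 := h.bracket l m a b z.2
    rw [C_add] at h2
    simp only [LinearMap.mk₂_apply, Prod.fst_sub, map_add]
    rw [← h1]
    change _ + svAct α 0 Δ' l a _ + (svAct α 0 Δ m b z.2).comp _ * _ - (_ + svAct α 0 Δ' m b _ +
      (svAct α 0 Δ l a z.2).comp _ * _) = _ + z.2.comp _ *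
        cocycleSum (cocycleFamily f 0 0 k) (l + m) (svBracket l a b)
    rw [← h2]
    ring
  act_D l a z := by
    refine Prod.ext ?_ ((svModule α 0 Δ).act_D l a z.2)
    have h1 := (svModule α 0 Δ').act_D l a z.1
    simp only [LinearMap.mk₂_apply, Prod.smul_fst, smul_add]
    rw [h1]
    change _ + _ * cocycleSum _ l ((X : ℂ[X]) • a) = _
    simp only [cocycleSum_eq, Pi.smul_apply, smul_eq_mul, eval_mul, eval_X, C_mul, smul_eq_C_mul]
    ring
  D_act l a z := by
    refine Prod.ext ?_ ((svModule α 0 Δ).D_act l a z.2)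
    have h1 := (svModule α 0 Δ').D_act l a z.1
    simp only [LinearMap.mk₂_apply, Prod.smul_fst, smul_add, Prod.fst_sub, LinearMap.prodMap_apply,
      LinearMap.mulLeft_apply, mul_add, mul_comp, X_comp]
    rw [← h1]
    change _ = X * _ - (svModule α 0 Δ').act l a (X * z.1) + _
    rw [smul_eq_C_mul, C_neg]
    ring

/-- The extension defined by a cocycle. -/
noncomputable def extension (h : IsSVCocycle α Δ Δ' f k) :
    ConformalModule.Extension.{0, 0, 0, 0} (svModule α 0 Δ') (svModule α 0 Δ) where
  carrier := ℂ[X] × ℂ[X]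
  str := h.module
  i := LinearMap.inl ℂ ℂ[X] ℂ[X]
  p := LinearMap.snd ℂ ℂ[X] ℂ[X]
  i_isHom := ⟨fun p => by simp [module, svModule], fun l a p => by
    simp only [module, svModule, LinearMap.mk₂_apply, LinearMap.inl_apply]
    simp [svAct]⟩
  p_isHom := by constructor <;> intros <;> simp [module, svModule]
  injective := LinearMap.inl_injective
  exact := by
    rintro ⟨x, y⟩
    simp [eq_comm]
  surjective := LinearMap.snd_surjective

theorem hasCocycle_extension (h : IsSVCocycle α Δ Δ' f k) : HasCocycle h.extension f 0 0 k := by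
  refine ⟨((0, 1) : ℂ[X] × ℂ[X]), rfl, fun l => ?_⟩
  have key : ∀ s, h.extension.str.act l (svGen s) ((0, 1) : ℂ[X] × ℂ[X]) =
      (((cocycleFamily f 0 0 k s).eval (C l), svCoeff α 0 Δ l s) : ℂ[X] × ℂ[X]) := by
    intro s
    refine Prod.ext ?_ ?_
    · change svAct α 0 Δ' l (svGen s) 0 + (1 : ℂ[X]).comp _ * _ = _
      rw [svAct_svGen, cocycleSum, Finset.sum_eq_single s]
      · simp [svGen]
      · intro t _ ht
        simp [svGen, Pi.single_eq_of_ne ht]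
      · simp
    · change svAct α 0 Δ l (svGen s) 1 = _
      rw [svAct_svGen, one_comp, one_mul]
  refine ⟨?_, ?_, ?_, ?_⟩ <;> rw [key]
  · refine Prod.ext ?_ ?_
    · change _ = X * 0 + (α + Δ * l) • 0 + f.eval (C l)
      simp [cocycleFamily]
    · change _ = X * 1 + (α + Δ * l) • 1 + 0
      simp [svCoeff, smul_eq_C_mul, add_assoc]
  · exact Prod.ext rfl rfl
  · exact Prod.ext rfl rfl
  · refine Prod.ext ?_ ?_
    · change _ = (0 : ℂ) • (0 : ℂ[X]) + k.eval (C l)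
      simp [cocycleFamily]
    · change _ = (0 : ℂ) • (1 : ℂ[X]) + 0
      simp [svCoeff]

end IsSVCocycle

/-! ### Change of lift and triviality -/

namespace ConformalModule.Extension

variable {α Δ Δ' : ℂ} {E : Extension.{0, 0, 0, x} (svModule α 0 Δ') (svModule α 0 Δ)}

/-- Changing the lift of the generator changes `f` by a coboundary. -/
theorem hasCocycle_of_cohomologous {f f' g h k : BiPoly} (hE : HasCocycle E f g h k) {φ : ℂ[X]}
    (hf : ∀ x y, biEval (biShift α f) x y =
      virCobdry Δ Δ' φ x y + biEval (biShift α f') x y)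
    (hg : g = 0) (hh : h = 0) : HasCocycle E f' 0 0 k := by
  obtain ⟨v, hv, H⟩ := hE
  have hact : ∀ l s p, E.str.act l (svGen s) (E.i p) =
      E.i (p.comp (X + C l) * svCoeff α 0 Δ' l s) := by
    intro l s p
    rw [← svAct_svGen]
    exact (E.i_isHom.2 l (svGen s) p).symm
  -- The coboundary is written in the shifted variable, so `φ` is evaluated at `∂ + α`. Since `M`,
  -- `Y`, `N` annihilate the submodule, only `f` changes.
  refine ⟨v - E.i (φ.comp (X + C α)), by rw [map_sub, hv, p_i, sub_zero], fun l => ?_⟩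
  obtain ⟨h1, h2, h3, h4⟩ := H l
  simp only [map_sub, hact, h1, h2, h3, h4, hg, hh, svCoeff]
  refine ⟨?_, by simp, by simp, by simp⟩
  have hD : ∀ p, E.str.D (E.i p) = E.i (X * p) := fun p => (E.i_isHom.1 p).symm
  have e : f.eval (C l) = (φ.comp (X + C α)).comp (X + C l) * (X + C α + C (Δ' * l)) -
      (X + C α + C (Δ * l)) * φ.comp (X + C α) + f'.eval (C l) := by
    refine Polynomial.funext fun x => ?_
    have := hf (x + α) l
    rw [biEval_biShift, biEval_biShift, add_sub_cancel_right] at this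
    simp only [biEval, virCobdry] at this
    simp only [eval_add, eval_sub, eval_mul, eval_comp, eval_X, eval_C, add_right_comm x l α]
    linear_combination this
  rw [e, hD, smul_sub, ← map_smul, map_add, map_sub]
  simp only [smul_eq_C_mul, add_mul, map_add]
  abel

theorem hasCocycle_split : HasCocycle (split (svModule α 0 Δ') (svModule α 0 Δ)) 0 0 0 0 := by
  refine ⟨((0, 1) : ℂ[X] × ℂ[X]), rfl, fun l => ?_⟩
  have key : ∀ s, (split (svModule α 0 Δ') (svModule α 0 Δ)).str.act l (svGen s)
      ((0, 1) : ℂ[X] × ℂ[X]) = ((0, svCoeff α 0 Δ l s) : ℂ[X] × ℂ[X]) := by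
    intro s
    refine Prod.ext ?_ ?_
    · change svAct α 0 Δ' l (svGen s) 0 = _
      rw [svAct_svGen, zero_comp, zero_mul]
    · change svAct α 0 Δ l (svGen s) 1 = _
      rw [svAct_svGen, one_comp, one_mul]
  refine ⟨?_, ?_, ?_, ?_⟩ <;> rw [key]
  · refine Prod.ext ?_ ?_
    · change _ = X * 0 + (α + Δ * l) • 0 + (0 : BiPoly).eval (C l)
      simp
    · change _ = X * 1 + (α + Δ * l) • 1 + 0
      simp [svCoeff, smul_eq_C_mul, add_assoc]
  · refine Prod.ext ?_ rfl
    exact eval_zero.symm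
  · refine Prod.ext ?_ rfl
    exact eval_zero.symm
  · refine Prod.ext ?_ ?_
    · change _ = (0 : ℂ) • (0 : ℂ[X]) + (0 : BiPoly).eval (C l)
      simp
    · change _ = (0 : ℂ) • (1 : ℂ[X]) + 0
      simp [svCoeff]

theorem isTrivial_of_hasCocycle (h : HasCocycle E 0 0 0 0) : E.IsTrivial := by
  obtain ⟨v, hv⟩ := E.hasCocycle_iff.mp h
  obtain ⟨v', hv'⟩ := (hasCocycle_iff _).mp (hasCocycle_split (α := α) (Δ := Δ) (Δ' := Δ'))
  exact equivalent_of_realizes hv hv'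

/-- An equivalence with the direct sum sends `v` to some `(p, 1)` with the same cocycle. Computed in
the direct sum, that cocycle is the coboundary of `p` in the `L` component and zero in the `N`
component. -/
theorem cobdry_of_isTrivial {f g h k : BiPoly} (hE : HasCocycle E f g h k) (ht : E.IsTrivial) :
    k = 0 ∧ ∃ φ : ℂ[X], ∀ x y, biEval (biShift α f) x y = virCobdry Δ Δ' φ x y := by
  obtain ⟨v, hv⟩ := E.hasCocycle_iff.mp hE
  obtain ⟨⟨p, q⟩, hq, H⟩ := hv.of_equivalent ht
  have hq : q = 1 := hq
  subst hq
  obtain ⟨v', hv'⟩ := (hasCocycle_iff _).mp (hasCocycle_split (α := α) (Δ := Δ) (Δ' := Δ'))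
  have key : ∀ l s, svAct α 0 Δ' l (svGen s) p =
      svCoeff α 0 Δ l s * p + (cocycleFamily f g h k s).eval (C l) := by
    intro l s
    have h1 := congrArg Prod.fst (H l s)
    have h2 : ((p, 1) : ℂ[X] × ℂ[X]) = (p, 0) + (0, 1) := by simp
    have h3 : ∀ r : ℂ[X], (aeval (split (svModule α 0 Δ') (svModule α 0 Δ)).str.D r
        ((p, 1) : ℂ[X] × ℂ[X]) : ℂ[X] × ℂ[X]).1 = r * p := by
      intro r
      have hfst : (split (svModule α 0 Δ') (svModule α 0 Δ)).str.IsHom (svModule α 0 Δ')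
          (LinearMap.fst ℂ ℂ[X] ℂ[X]) := ⟨fun _ => rfl, fun _ _ _ => rfl⟩
      exact (hfst.map_aeval r _).trans (svModule_aeval _ _ _ _ _)
    refine h1.trans ?_
    change (aeval (split (svModule α 0 Δ') (svModule α 0 Δ)).str.D _
        ((p, 1) : ℂ[X] × ℂ[X]) : ℂ[X] × ℂ[X]).1 + _ = _
    rw [h3]
    rfl
  constructor
  · refine BiPoly.ext_eval fun l => ?_
    have := key l .N
    simp [svAct_svGen, svCoeff, cocycleFamily] at this
    simp [this]
  · refine ⟨p.comp (X - C α), fun x y => ?_⟩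
    have := congrArg (eval (x - α)) (key y .L)
    simp [svAct_svGen, svCoeff, cocycleFamily, eval_comp] at this
    rw [biEval_biShift, biEval, virCobdry]
    simp only [eval_comp, eval_sub, eval_X, eval_C, add_sub_right_comm x y α]
    linear_combination -this

end ConformalModule.Extension

/-! ### Matching with the list -/

theorem vir_classification {a b : ℂ} (hb : b ≠ 0) {f : BiPoly}
    (h : IsVirCocycle a b (biEval f)) :
    (∃ φ : ℂ[X], ∀ x y, biEval f x y = virCobdry a b φ x y) ∨
      (a = b ∧ ∃ (φ : ℂ[X]) (c₀ c₁ : ℂ), ∀ x y,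
        biEval f x y = virCobdry a b φ x y + (c₀ + c₁ * y)) ∨
      ∃ n : ℕ, IsVirSpecial b n ∧ a = b + n ∧ ∃ (φ : ℂ[X]) (c : ℂ), ∀ x y,
        biEval f x y = virCobdry a b φ x y + c * biEval (homPoly (n + 1) (virRep b n)) x y := by
  rcases vir_normal_form hb h with h | h | ⟨n, hn, rfl, φ, f', hf, hf'⟩
  · exact Or.inl h
  · exact Or.inr (Or.inl h)
  · have hadd : ∀ ψ x y, virCobdry (b + n) b (φ + ψ) x y =
        virCobdry (b + n) b φ x y + virCobdry (b + n) b ψ x y := by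
      intro ψ x y
      simp only [virCobdry, eval_add]
      ring
    rcases hf'.classification hb hn with ⟨ψ, hψ⟩ | ⟨hs, ψ, c, hψ⟩
    · exact Or.inl ⟨φ + ψ, fun x y => by rw [hf, hψ, hadd]⟩
    · exact Or.inr (Or.inr ⟨n, hs, rfl, φ + ψ, c, fun x y => by rw [hf, hψ, hadd]; ring⟩)

theorem biEval_biShift_eq_eval (α : ℂ) (f : BiPoly) (x y : ℂ) :
    biEval (biShift α f) x y = (f.eval (C y)).eval (x - α) := biEval_biShift α f x y

theorem biShift_injective {α : ℂ} {f g : BiPoly}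
    (h : ∀ x y, biEval (biShift α f) x y = biEval (biShift α g) x y) : f = g :=
  BiPoly.ext_biEval fun x y => by
    simpa only [biEval_biShift, add_sub_cancel_right] using h (x + α) y

section Representatives

variable (α b c x y : ℂ)

theorem biEval_affine (c₀ c₁ : ℂ) :
    biEval (biShift α (biC c₀ + biC c₁ * biL)) x y = c₀ + c₁ * y := by
  simp [biEval_biShift_eq_eval, biC, biL]

theorem biEval_virRep_two :
    biEval (biShift α (biC c * (biL ^ 2 * (2 * biD α + biL)))) x y =
      c * biEval (homPoly (2 + 1) (virRep b 2)) x y := by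
  simp [biEval_biShift_eq_eval, biC, biL, biD, biEval_homPoly, Finset.sum_range_succ, virRep,
    -mul_eq_mul_left_iff]
  ring

theorem biEval_virRep_three :
    biEval (biShift α (biC c * (biD α * biL ^ 2 * (biD α + biL)))) x y =
      c * biEval (homPoly (3 + 1) (virRep b 3)) x y := by
  simp [biEval_biShift_eq_eval, biC, biL, biD, biEval_homPoly, Finset.sum_range_succ, virRep,
    -mul_eq_mul_left_iff]
  ring

theorem biEval_virRep_four :
    biEval (biShift α (biC c * (biL ^ 2 * (4 * biD α ^ 3 + 6 * biD α ^ 2 * biL -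
      biD α * biL ^ 2 + biC b * biL ^ 3)))) x y =
      c * biEval (homPoly (4 + 1) (virRep b 4)) x y := by
  simp [biEval_biShift_eq_eval, biC, biL, biD, biEval_homPoly, Finset.sum_range_succ, virRep,
    -mul_eq_mul_left_iff]
  ring

theorem biEval_virRep_five :
    biEval (biShift α (biC c * (biD α ^ 4 * biL ^ 2 - 10 * biD α ^ 2 * biL ^ 4 -
      17 * biD α * biL ^ 5 - 8 * biL ^ 6))) x y =
      c * biEval (homPoly (5 + 1) (virRep b 5)) x y := by
  simp [biEval_biShift_eq_eval, biC, biL, biD, biEval_homPoly, Finset.sum_range_succ, virRep,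
    -mul_eq_mul_left_iff]
  ring

theorem biEval_virRep_six :
    biEval (biShift α (biC c * (biD α ^ 4 * biL ^ 3 - biC (2 * b + 3) * biD α ^ 3 * biL ^ 4 -
      biC (3 * b) * biD α ^ 2 * biL ^ 5 - biC (3 * b + 1) * biD α * biL ^ 6 -
      biC (b + 9 / 28) * biL ^ 7))) x y =
      c * biEval (homPoly (6 + 1) (virRep b 6)) x y := by
  simp [biEval_biShift_eq_eval, biC, biL, biD, biEval_homPoly, Finset.sum_range_succ, virRep,
    -mul_eq_mul_left_iff]
  ring

theorem biEval_cur_zero : biEval (biShift α (biC c)) x y = c := by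
  simp [biEval_biShift_eq_eval, biC]

theorem biEval_cur_one : biEval (biShift α (biC c * biL)) x y = c * y := by
  simp [biEval_biShift_eq_eval, biC, biL]

theorem biEval_cur_two :
    biEval (biShift α (biC c * (biL * (biD α - biC b * biL)))) x y = c * (y * (x - b * y)) := by
  simp [biEval_biShift_eq_eval, biC, biL, biD]

theorem biEval_cur_three :
    biEval (biShift α (biC c * (biL * (biD α ^ 2 + 3 * biD α * biL + 2 * biL ^ 2)))) x y =
      c * (y * (x ^ 2 + 3 * x * y + 2 * y ^ 2)) := by
  simp [biEval_biShift_eq_eval, biC, biL, biD]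

theorem biEval_zero : biEval (biShift α 0) x y = 0 := by
  simp [biEval_biShift_eq_eval]

end Representatives

theorem sqrt_nineteen_sq : ((√19 : ℝ) : ℂ) ^ 2 = 19 := by
  exact_mod_cast congrArg (fun t : ℝ => (t : ℂ)) (Real.sq_sqrt (show (0 : ℝ) ≤ 19 by norm_num))

/-- The roots of `b² + 5b + 3/2` are `(-5 ± √19)/2`, the discriminant being `25 - 6 = 19`. -/
theorem diff_six_iff {a b : ℂ} :
    ((a, b) = (7 / 2 + ((√19 : ℝ) : ℂ) / 2, -5 / 2 + ((√19 : ℝ) : ℂ) / 2) ∨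
      (a, b) = (7 / 2 - ((√19 : ℝ) : ℂ) / 2, -5 / 2 - ((√19 : ℝ) : ℂ) / 2)) ↔
      a = b + 6 ∧ b ^ 2 + 5 * b + 3 / 2 = 0 := by
  have h19 := sqrt_nineteen_sq
  generalize ((√19 : ℝ) : ℂ) = r at *
  simp only [Prod.mk.injEq]
  constructor
  · rintro (⟨rfl, rfl⟩ | ⟨rfl, rfl⟩)
    · exact ⟨by ring, by linear_combination h19 / 4⟩
    · exact ⟨by ring, by linear_combination h19 / 4⟩
  · rintro ⟨rfl, hb⟩
    have : (b + 5 / 2 - r / 2) * (b + 5 / 2 + r / 2) = 0 := by linear_combination hb - h19 / 4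
    rcases mul_eq_zero.mp this with h | h
    · exact Or.inl ⟨by linear_combination h, by linear_combination h⟩
    · exact Or.inr ⟨by linear_combination h, by linear_combination h⟩

/-- The special value of `n` determines the shape of a Virasoro cocycle. -/
theorem vir_classification_of_special {a b : ℂ} (hb : b ≠ 0) {f : BiPoly}
    (h : IsVirCocycle a b (biEval f)) {n : ℕ} (hs : IsVirSpecial b n) (hn : a = b + n) :
    ∃ (φ : ℂ[X]) (c : ℂ), ∀ x y, biEval f x y = virCobdry a b φ x y +
      c * biEval (homPoly (n + 1) (virRep b n)) x y := by
  rcases vir_classification hb h with ⟨φ, hφ⟩ | ⟨hab, -⟩ | ⟨n', -, hn', H⟩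
  · exact ⟨φ, 0, fun x y => by rw [hφ, zero_mul, add_zero]⟩
  · have h0 : (n : ℂ) = 0 := by linear_combination hab - hn
    have h0 : n = 0 := by exact_mod_cast h0
    rcases hs with h | h | h | h | h <;> omega
  · have : (n' : ℂ) = n := by linear_combination hn - hn'
    obtain rfl : n' = n := by exact_mod_cast this
    exact H

/-- The last clause is the exact negation of what `cobdry_of_isTrivial` extracts from a trivial
extension. It holds because a nonzero constant in `k` makes `k ≠ 0`, and a nonzero constant in `f`
makes `f` a non-coboundary. -/
theorem IsListedCocycle.spec {α Δ Δ' : ℂ} (hΔ' : Δ' ≠ 0) {f g h k : BiPoly}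
    (H : IsListedCocycle α Δ Δ' f g h k) : g = 0 ∧ h = 0 ∧ IsSVCocycle α Δ Δ' f k ∧
      ¬(k = 0 ∧ ∃ φ : ℂ[X], ∀ x y, biEval (biShift α f) x y = virCobdry Δ Δ' φ x y) := by
  have vir : ∀ {n : ℕ} {c : ℂ} {f : BiPoly}, IsVirSpecial Δ' n → Δ = Δ' + n →
      (∀ x y, biEval (biShift α f) x y = c * biEval (homPoly (n + 1) (virRep Δ' n)) x y) →
      IsVirCocycle Δ Δ' (biEval (biShift α f)) ∧
        ((∃ φ : ℂ[X], ∀ x y, biEval (biShift α f) x y = virCobdry Δ Δ' φ x y) → c = 0) := by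
    rintro n c f hs rfl hf
    constructor
    · rw [funext₂ hf]
      exact (isVirNormal_virRep hΔ' hs).1.cocycle.const_mul c
    · rintro ⟨φ, hφ⟩
      exact virRep_not_cobdry hΔ' hs fun x y => by rw [← hf, hφ]
  have cur : IsCurCocycle Δ Δ' (biEval (biShift α 0)) := by
    intro x l m
    simp only [biEval_zero]
    ring
  have zero_of : ∀ {k : BiPoly}, k = 0 → ∀ x y, biEval (biShift α k) x y = 0 := by
    rintro k rfl x y
    exact biEval_zero α x y
  cases H with
  | diff_zero c₀ c₁ a₀ hΔ hne =>
    subst hΔ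
    refine ⟨rfl, rfl, ⟨?_, ?_⟩, ?_⟩
    · intro x l m
      simp only [biEval_affine]
      ring
    · intro x l m
      simp only [biEval_cur_zero]
      ring
    · rintro ⟨hk, φ, hφ⟩
      have h0 := zero_of hk 0 0
      rw [biEval_cur_zero] at h0
      obtain ⟨h1, h2⟩ := affine_not_cobdry (φ := φ) fun x y => by rw [← hφ, biEval_affine]
      exact hne (by rw [h0, h1, h2])
  | diff_one a₁ hΔ hne =>
    refine ⟨rfl, rfl, ⟨?_, ?_⟩, ?_⟩
    · intro x l m
      simp only [biEval_zero]
      ring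
    · intro x l m
      simp only [biEval_cur_one]
      linear_combination (-a₁ * m * l) * hΔ
    · rintro ⟨hk, -⟩
      have h0 := zero_of hk 0 1
      rw [biEval_cur_one] at h0
      exact hne (by simpa using h0)
  | diff_two c₂ a₂ hΔ hne =>
    obtain ⟨h1, h2⟩ := vir (n := 2) (Or.inl rfl) (by push_cast; linear_combination hΔ)
      (biEval_virRep_two α Δ' c₂)
    refine ⟨rfl, rfl, ⟨h1, ?_⟩, ?_⟩
    · obtain rfl : Δ = Δ' + 2 := by linear_combination hΔ
      intro x l m
      simp only [biEval_cur_two]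
      ring
    · rintro ⟨hk, hφ⟩
      -- At `∂ + α = Δ' + 1`, `λ = 1` the polynomial `λ(∂ + α - Δ'λ)` equals `1`.
      have h0 := zero_of hk (Δ' + 1) 1
      rw [biEval_cur_two] at h0
      exact hne (by rw [h2 hφ]; simpa using h0)
  | diff_three_special c₃ a₃ hΔ hne =>
    obtain ⟨rfl, rfl⟩ := Prod.mk.inj hΔ
    obtain ⟨h1, h2⟩ := vir (n := 3) (Or.inr (Or.inl rfl)) (by norm_num)
      (biEval_virRep_three α (-2) c₃)
    refine ⟨rfl, rfl, ⟨h1, ?_⟩, ?_⟩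
    · intro x l m
      simp only [biEval_cur_three]
      ring
    · rintro ⟨hk, hφ⟩
      have h0 := zero_of hk 0 1
      rw [biEval_cur_three] at h0
      exact hne (by rw [h2 hφ]; simpa using h0)
  | diff_three c₃ hΔ hΔ'' hne =>
    obtain ⟨h1, h2⟩ := vir (n := 3) (Or.inr (Or.inl rfl)) (by push_cast; linear_combination hΔ)
      (biEval_virRep_three α Δ' c₃)
    exact ⟨rfl, rfl, ⟨h1, cur⟩, fun ⟨_, hφ⟩ => hne (h2 hφ)⟩
  | diff_four c₅ hΔ hne =>
    obtain ⟨h1, h2⟩ := vir (n := 4) (Or.inr (Or.inr (Or.inl rfl)))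
      (by push_cast; linear_combination hΔ) (biEval_virRep_four α Δ' c₅)
    exact ⟨rfl, rfl, ⟨h1, cur⟩, fun ⟨_, hφ⟩ => hne (h2 hφ)⟩
  | diff_five c₆ hΔ hne =>
    obtain ⟨hΔ₁, hΔ₂⟩ := Prod.mk.inj hΔ
    obtain ⟨h1, h2⟩ := vir (n := 5) (Or.inr (Or.inr (Or.inr (Or.inl ⟨rfl, hΔ₂⟩))))
      (by rw [hΔ₁, hΔ₂]; norm_num) (biEval_virRep_five α Δ' c₆)
    exact ⟨rfl, rfl, ⟨h1, cur⟩, fun ⟨_, hφ⟩ => hne (h2 hφ)⟩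
  | diff_six c₇ hΔ hne =>
    obtain ⟨hΔ₁, hΔ₂⟩ := diff_six_iff.mp hΔ
    obtain ⟨h1, h2⟩ := vir (n := 6) (Or.inr (Or.inr (Or.inr (Or.inr ⟨rfl, hΔ₂⟩))))
      (by rw [hΔ₁]; norm_num) (biEval_virRep_six α Δ' c₇)
    exact ⟨rfl, rfl, ⟨h1, cur⟩, fun ⟨_, hφ⟩ => hne (h2 hφ)⟩

/-- Every pair `(f, k)` of cocycles is cohomologous to zero or to a listed one. -/
theorem IsSVCocycle.classification {α Δ Δ' : ℂ} (hΔ' : Δ' ≠ 0) {f k : BiPoly}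
    (h : IsSVCocycle α Δ Δ' f k) : ∃ (φ : ℂ[X]) (f' : BiPoly),
      (∀ x y, biEval (biShift α f) x y =
        virCobdry Δ Δ' φ x y + biEval (biShift α f') x y) ∧
      ((f' = 0 ∧ k = 0) ∨
        ((∃ n : ℕ, n ≤ 6 ∧ Δ - Δ' = n) ∧ IsListedCocycle α Δ Δ' f' 0 0 k)) := by
  obtain ⟨hf, hk⟩ := h
  have hk := cur_classification hΔ' hk
  have hkz : biShift α k = 0 → k = 0 := fun h0 =>
    biShift_injective fun x y => by rw [h0, biEval_zero, biEval, eval_zero, eval_zero]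
  have num : ∀ {s t : ℕ}, Δ - Δ' = s → Δ - Δ' = t → s = t := fun h1 h2 =>
    Nat.cast_injective (R := ℂ) (h1.symm.trans h2)
  have bc0 : ∀ P, biC 0 * P = 0 := by simp [biC]
  by_cases hn : ∃ n : ℕ, n ≤ 6 ∧ Δ - Δ' = n
  swap
  · have hk0 : k = 0 := by
      rcases hk with h | ⟨h, -⟩ | ⟨h, -⟩ | ⟨h, -⟩ | ⟨h, h', -⟩
      · exact hkz h
      · exact absurd ⟨0, by omega, by simp [h]⟩ hn
      · exact absurd ⟨1, by omega, by simp [h]⟩ hn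
      · exact absurd ⟨2, by omega, by simp [h]⟩ hn
      · exact absurd ⟨3, by omega, by rw [h, h']; norm_num⟩ hn
    rcases vir_classification hΔ' hf with ⟨φ, hφ⟩ | ⟨h, -⟩ | ⟨n, hs, h, -⟩
    · exact ⟨φ, 0, fun x y => by rw [hφ, biEval_zero, add_zero], Or.inl ⟨rfl, hk0⟩⟩
    · exact absurd ⟨0, by omega, by simp [h]⟩ hn
    · refine absurd ⟨n, ?_, by rw [h]; ring⟩ hn
      rcases hs with h | h | h | h | h <;> omega
  obtain ⟨n, hn6, hn⟩ := hn
  have hΔ : Δ = Δ' + n := by linear_combination hn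
  have hex : ∃ n : ℕ, n ≤ 6 ∧ Δ - Δ' = n := ⟨n, hn6, hn⟩
  have hk1 : n ≠ 0 → n ≠ 1 → n ≠ 2 → (n = 3 → Δ' ≠ -2) → k = 0 := by
    intro h0 h1 h2 h3
    rcases hk with h | ⟨h, -⟩ | ⟨h, -⟩ | ⟨h, -⟩ | ⟨h, h', -⟩
    · exact hkz h
    · exact absurd (num hn (t := 0) (by simp [h])) h0
    · exact absurd (num hn (t := 1) (by simp [h])) h1
    · exact absurd (num hn (t := 2) (by simp [h])) h2
    · exact absurd h' (h3 (num hn (t := 3) (by rw [h, h']; norm_num)))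
  have trivial_case : ¬IsVirSpecial Δ' n → n ≠ 0 →
      ∃ φ : ℂ[X], ∀ x y, biEval (biShift α f) x y = virCobdry Δ Δ' φ x y := by
    intro hs h0
    rcases vir_classification hΔ' hf with h | ⟨h, -⟩ | ⟨m, hs', h, -⟩
    · exact h
    · exact absurd (num hn (t := 0) (by simp [h])) h0
    · obtain rfl : n = m := num hn (by rw [h]; ring)
      exact absurd hs' hs
  have special_case := fun hs : IsVirSpecial Δ' n => vir_classification_of_special hΔ' hf hs hΔ
  obtain rfl | rfl | rfl | rfl | rfl | rfl | rfl : n = 0 ∨ n = 1 ∨ n = 2 ∨ n = 3 ∨ n = 4 ∨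
    n = 5 ∨ n = 6 := by omega
  · obtain ⟨φ, c₀, c₁, hφ⟩ : ∃ (φ : ℂ[X]) (c₀ c₁ : ℂ), ∀ x y,
        biEval (biShift α f) x y = virCobdry Δ Δ' φ x y + (c₀ + c₁ * y) := by
      rcases vir_classification hΔ' hf with ⟨φ, h⟩ | ⟨-, h⟩ | ⟨m, hs, h, -⟩
      · exact ⟨φ, 0, 0, fun x y => by rw [h]; ring⟩
      · exact h
      · have := num hn (t := m) (by rw [h]; ring)
        rcases hs with h | h | h | h | h <;> omega
    obtain ⟨a₀, ha₀⟩ : ∃ a₀, k = biC a₀ := by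
      rcases hk with h | ⟨-, c, h⟩ | ⟨h, -⟩ | ⟨h, -⟩ | ⟨h, h', -⟩
      · exact ⟨0, by rw [hkz h]; simp [biC]⟩
      · exact ⟨c, biShift_injective fun x y => by rw [h, biEval_cur_zero]⟩
      · exact absurd (num hn (t := 1) (by simp [h])) (by omega)
      · exact absurd (num hn (t := 2) (by simp [h])) (by omega)
      · exact absurd (num hn (t := 3) (by rw [h, h']; norm_num)) (by omega)
    refine ⟨φ, biC c₀ + biC c₁ * biL, fun x y => by rw [hφ, biEval_affine], ?_⟩
    by_cases hne : (c₀, c₁, a₀) = (0, 0, 0)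
    · simp only [Prod.mk.injEq] at hne
      refine Or.inl ⟨?_, ?_⟩
      · simp [hne, biC]
      · simp [ha₀, hne, biC]
    · rw [ha₀]
      exact Or.inr ⟨hex, .diff_zero c₀ c₁ a₀ (by simpa using hΔ) hne⟩
  · obtain ⟨φ, hφ⟩ := trivial_case (by simp [IsVirSpecial]) one_ne_zero
    obtain ⟨a₁, ha₁⟩ : ∃ a₁, k = biC a₁ * biL := by
      rcases hk with h | ⟨h, -⟩ | ⟨-, c, h⟩ | ⟨h, -⟩ | ⟨h, h', -⟩
      · exact ⟨0, by rw [hkz h, bc0]⟩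
      · exact absurd (num hn (t := 0) (by simp [h])) (by omega)
      · exact ⟨c, biShift_injective fun x y => by rw [h, biEval_cur_one]⟩
      · exact absurd (num hn (t := 2) (by simp [h])) (by omega)
      · exact absurd (num hn (t := 3) (by rw [h, h']; norm_num)) (by omega)
    refine ⟨φ, 0, fun x y => by rw [hφ, biEval_zero, add_zero], ?_⟩
    by_cases hne : a₁ = 0
    · exact Or.inl ⟨rfl, by rw [ha₁, hne, bc0]⟩
    · rw [ha₁]
      exact Or.inr ⟨hex, .diff_one a₁ (by simpa using hn) hne⟩
  · obtain ⟨φ, c₂, hφ⟩ := special_case (Or.inl rfl)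
    obtain ⟨a₂, ha₂⟩ : ∃ a₂, k = biC a₂ * (biL * (biD α - biC Δ' * biL)) := by
      rcases hk with h | ⟨h, -⟩ | ⟨h, -⟩ | ⟨-, c, h⟩ | ⟨h, h', -⟩
      · exact ⟨0, by rw [hkz h, bc0]⟩
      · exact absurd (num hn (t := 0) (by simp [h])) (by omega)
      · exact absurd (num hn (t := 1) (by simp [h])) (by omega)
      · exact ⟨c, biShift_injective fun x y => by rw [h, biEval_cur_two]⟩
      · exact absurd (num hn (t := 3) (by rw [h, h']; norm_num)) (by omega)
    refine ⟨φ, _, fun x y => (hφ x y).trans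
      (congrArg (virCobdry Δ Δ' φ x y + ·) (biEval_virRep_two α Δ' c₂ x y).symm), ?_⟩
    by_cases hne : (c₂, a₂) = (0, 0)
    · obtain ⟨rfl, rfl⟩ := Prod.mk.inj hne
      exact Or.inl ⟨bc0 _, by rw [ha₂, bc0]⟩
    · rw [ha₂]
      exact Or.inr ⟨hex, .diff_two c₂ a₂ (by simpa using hn) hne⟩
  · obtain ⟨φ, c₃, hφ⟩ := special_case (Or.inr (Or.inl rfl))
    refine ⟨φ, _, fun x y => (hφ x y).trans
      (congrArg (virCobdry Δ Δ' φ x y + ·) (biEval_virRep_three α Δ' c₃ x y).symm), ?_⟩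
    by_cases h2 : Δ' = -2
    · obtain ⟨a₃, ha₃⟩ : ∃ a₃,
          k = biC a₃ * (biL * (biD α ^ 2 + 3 * biD α * biL + 2 * biL ^ 2)) := by
        rcases hk with h | ⟨h, -⟩ | ⟨h, -⟩ | ⟨h, -⟩ | ⟨-, -, c, h⟩
        · exact ⟨0, by rw [hkz h, bc0]⟩
        · exact absurd (num hn (t := 0) (by simp [h])) (by omega)
        · exact absurd (num hn (t := 1) (by simp [h])) (by omega)
        · exact absurd (num hn (t := 2) (by simp [h])) (by omega)
        · exact ⟨c, biShift_injective fun x y => by rw [h, biEval_cur_three]⟩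
      by_cases hne : (c₃, a₃) = (0, 0)
      · obtain ⟨rfl, rfl⟩ := Prod.mk.inj hne
        exact Or.inl ⟨bc0 _, by rw [ha₃, bc0]⟩
      · rw [ha₃]
        exact Or.inr ⟨hex, .diff_three_special c₃ a₃ (by rw [hΔ, h2]; norm_num) hne⟩
    · obtain rfl := hk1 (by omega) (by omega) (by omega) fun _ => h2
      by_cases hne : c₃ = 0
      · exact Or.inl ⟨by rw [hne, bc0], rfl⟩
      · exact Or.inr ⟨hex, .diff_three c₃ (by simpa using hn) h2 hne⟩
  · obtain ⟨φ, c₅, hφ⟩ := special_case (Or.inr (Or.inr (Or.inl rfl)))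
    obtain rfl := hk1 (by omega) (by omega) (by omega) (by omega)
    refine ⟨φ, _, fun x y => (hφ x y).trans
      (congrArg (virCobdry Δ Δ' φ x y + ·) (biEval_virRep_four α Δ' c₅ x y).symm), ?_⟩
    by_cases hne : c₅ = 0
    · exact Or.inl ⟨by rw [hne, bc0], rfl⟩
    · exact Or.inr ⟨hex, .diff_four c₅ (by simpa using hn) hne⟩
  · obtain rfl := hk1 (by omega) (by omega) (by omega) (by omega)
    by_cases h4 : Δ' = -4
    · obtain ⟨φ, c₆, hφ⟩ := special_case (Or.inr (Or.inr (Or.inr (Or.inl ⟨rfl, h4⟩))))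
      refine ⟨φ, _, fun x y => (hφ x y).trans
      (congrArg (virCobdry Δ Δ' φ x y + ·) (biEval_virRep_five α Δ' c₆ x y).symm), ?_⟩
      by_cases hne : c₆ = 0
      · exact Or.inl ⟨by rw [hne, bc0], rfl⟩
      · exact Or.inr ⟨hex, .diff_five c₆ (by rw [hΔ, h4]; norm_num) hne⟩
    · obtain ⟨φ, hφ⟩ := trivial_case (by simp [IsVirSpecial, h4]) (by omega)
      exact ⟨φ, 0, fun x y => by rw [hφ, biEval_zero, add_zero], Or.inl ⟨rfl, rfl⟩⟩
  · obtain rfl := hk1 (by omega) (by omega) (by omega) (by omega)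
    by_cases h6 : Δ' ^ 2 + 5 * Δ' + 3 / 2 = 0
    · obtain ⟨φ, c₇, hφ⟩ := special_case (Or.inr (Or.inr (Or.inr (Or.inr ⟨rfl, h6⟩))))
      refine ⟨φ, _, fun x y => (hφ x y).trans
      (congrArg (virCobdry Δ Δ' φ x y + ·) (biEval_virRep_six α Δ' c₇ x y).symm), ?_⟩
      by_cases hne : c₇ = 0
      · exact Or.inl ⟨by rw [hne, bc0], rfl⟩
      · exact Or.inr ⟨hex, .diff_six c₇ (diff_six_iff.mpr ⟨by simpa using hΔ, h6⟩) hne⟩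
    · obtain ⟨φ, hφ⟩ := trivial_case (by simpa [IsVirSpecial] using h6) (by omega)
      exact ⟨φ, 0, fun x y => by rw [hφ, biEval_zero, add_zero], Or.inl ⟨rfl, rfl⟩⟩

theorem mainTheorem8 (α Δ Δ' : ℂ) (hΔ : Δ ≠ 0) (hΔ' : Δ' ≠ 0) :
    (∀ E : ConformalModule.Extension.{0, 0, 0, x} (svModule α 0 Δ') (svModule α 0 Δ),
      ¬E.IsTrivial →
        (∃ n : ℕ, n ≤ 6 ∧ Δ - Δ' = n) ∧
        ∃ f g h k : BiPoly, IsListedCocycle α Δ Δ' f g h k ∧ HasCocycle E f g h k) ∧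
    (∀ f g h k : BiPoly, IsListedCocycle α Δ Δ' f g h k →
      ∃ E₀ : ConformalModule.Extension.{0, 0, 0, 0} (svModule α 0 Δ') (svModule α 0 Δ),
        HasCocycle E₀ f g h k ∧ ¬E₀.IsTrivial ∧
        ∀ E : ConformalModule.Extension.{0, 0, 0, x} (svModule α 0 Δ') (svModule α 0 Δ),
          HasCocycle E f g h k → E.Equivalent E₀) := by
  constructor
  · intro E hE
    obtain ⟨v, c, hv⟩ := E.exists_realizes
    obtain ⟨hM, hY, hc⟩ := hv.isSVCocycle
    have hcf : cocycleFamily (c .L) (c .M) (c .Y) (c .N) = c := by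
      funext s
      cases s <;> rfl
    have hco : HasCocycle E (c .L) (c .M) (c .Y) (c .N) := by
      rw [E.hasCocycle_iff, hcf]
      exact ⟨v, hv⟩
    obtain ⟨φ, f', hf', h⟩ := hc.classification hΔ'
    have hco' := ConformalModule.Extension.hasCocycle_of_cohomologous hco hf' hM hY
    rcases h with ⟨rfl, hk⟩ | ⟨hn, hlist⟩
    -- A pair cohomologous to zero makes the extension trivial, so only listed cocycles remain.
    · rw [hk] at hco'
      exact absurd (ConformalModule.Extension.isTrivial_of_hasCocycle hco') hE
    · exact ⟨hn, f', 0, 0, c .N, hlist, hco'⟩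
  · intro f g h k H
    obtain ⟨rfl, rfl, hco, hnt⟩ := H.spec hΔ'
    refine ⟨hco.extension, hco.hasCocycle_extension, fun ht =>
      hnt (ConformalModule.Extension.cobdry_of_isTrivial hco.hasCocycle_extension ht),
      fun E hE => ?_⟩
    obtain ⟨v, hv⟩ := E.hasCocycle_iff.mp hE
    obtain ⟨v', hv'⟩ := hco.extension.hasCocycle_iff.mp hco.hasCocycle_extension
    exact ConformalModule.Extension.equivalent_of_realizes hv hv'
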